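/- Let $0<a<\tfrac13$, let $\mathbb{T}^2=\mathbb{R}^2/(2\pi\mathbb{Z})^2$, and let $G:\mathbb{T}^2\to\mathbb{T}^2$ be the map induced by $$(x,y)\mapsto\bigl(x+2a\sin x+a\sin y+a\sin(x-y),\; y+a\sin x+2a\sin y+a\sin(y-x)\bigr).$$ Then $G$ is a $C^1$ diffeomorphism of $\mathbb{T}^2$ and it is Morse–Smale, that is: (1) its nonwandering set $\Omega(G)$ is finite and consists of hyperbolic fixed or periodic points; (2) for every $z\in\mathbb{T}^2$ the $\omega$-limit set and the $\alpha$-limit set of the orbit of $z$ are each a fixed point or a periodic orbit; (3) the stable and unstable manifolds of all fixed and periodic points intersect transversely. Moreover $\Omega(G)$ consists of exactly six points, all of them hyperbolic fixed points of $G$: one source $(0,0)$; three saddles $(0,\pi)$, $(\pi,0)$, $(\pi,\pi)$; and two sinks $\left(\tfrac{2\pi}{3},\tfrac{4\pi}{3}\right)$, $\left(\tfrac{4\pi}{3},\tfrac{2\pi}{3}\right)$. (A fixed point $p$ is hyperbolic if $DG(p)$ has no complex eigenvalue of modulus $1$; it is a source, respectively a sink, if all eigenvalues have modulus $>1$, respectively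 $<1$, and a saddle if there are eigenvalues of both kinds.) -/

import Mathlib

open Set Filter Topology Function
open scoped Manifold ContDiff Real

/-! ### The circle `ℝ / pℤ` as a smooth manifold -/

noncomputable section

namespace AddCircleManifold

variable (p : ℝ) [hp : Fact (0 < p)]

/-- The charts of `ℝ / pℤ` are the local inverses of the projection `ℝ → ℝ / pℤ` on the
open intervals `(c, c + p)`.  The preferred chart at `x` uses the interval of length `p` centred
at the representative of `x` in `[0, p)`. -/
instance instChartedSpace : ChartedSpace ℝ (AddCircle p) where
  atlas := range fun c : ℝ => (AddCircle.openPartialHomeomorphCoe p c).symm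
  chartAt x :=
    (AddCircle.openPartialHomeomorphCoe p ((AddCircle.equivIco p 0 x : ℝ) - p / 2)).symm
  mem_chart_source x := by
    have h0 := hp.out
    have hx : ((AddCircle.equivIco p 0 x : ℝ) : AddCircle p) = x :=
      (AddCircle.equivIco p 0).symm_apply_apply x
    set r : ℝ := (AddCircle.equivIco p 0 x : ℝ) with hr
    have h := (AddCircle.openPartialHomeomorphCoe p (r - p / 2)).map_source (x := r)
      (show r ∈ Ioo (r - p / 2) (r - p / 2 + p) from ⟨by linarith, by linarith⟩)
    have h' : (r : AddCircle p) ∈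
        (AddCircle.openPartialHomeomorphCoe p (r - p / 2)).symm.source := h
    rwa [hx] at h'
  chart_mem_atlas x := mem_range_self _

/-- The transition maps are locally translations by multiples of `p`. -/
instance instIsManifold (n : WithTop ℕ∞) : IsManifold 𝓘(ℝ, ℝ) n (AddCircle p) := by
  apply isManifold_of_contDiffOn
  rintro _ _ ⟨b, rfl⟩ ⟨c, rfl⟩ t ht
  set e := AddCircle.openPartialHomeomorphCoe p b with he
  set e' := AddCircle.openPartialHomeomorphCoe p c with he'
  have ht1 : t ∈ e.source ∧ (t : AddCircle p) ∈ e'.target := by simpa [e, e'] using ht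
  apply ContDiffAt.contDiffWithinAt
  set s : ℝ := e'.symm (t : AddCircle p) with hs
  have hs1 : s ∈ e'.source := e'.map_target ht1.2
  have hs2 : (s : AddCircle p) = t := e'.right_inv ht1.2
  have hcont : ContinuousAt (fun u : ℝ => u + (s - t)) t := by fun_prop
  have hev : ∀ᶠ u in 𝓝 t, u + (s - t) ∈ e'.source :=
    hcont.eventually (e'.open_source.mem_nhds (by simpa using hs1))
  have key : (fun u : ℝ => u + (s - t)) =ᶠ[𝓝 t]
      (𝓘(ℝ, ℝ) ∘ (e.symm.symm ≫ₕ e'.symm) ∘ 𝓘(ℝ, ℝ).symm) := by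
    filter_upwards [hev] with u hu
    have h1 : ((u + (s - t) : ℝ) : AddCircle p) = u := by
      rw [AddCircle.coe_add, AddCircle.coe_sub, hs2, sub_self, add_zero]
    have h2 : e'.symm ((u + (s - t) : ℝ) : AddCircle p) = u + (s - t) := e'.left_inv hu
    rw [h1] at h2
    exact h2.symm
  exact (ContDiffAt.congr_of_eventuallyEq (by fun_prop) key.symm)

end AddCircleManifold

instance fact_two_pi_pos : Fact (0 < 2 * π) := ⟨Real.two_pi_pos⟩

/-! ### Nonwandering points, hyperbolicity and invariant manifolds -/

section Topological

variable {M : Type*} [TopologicalSpace M]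

/-- The nonwandering set: every neighbourhood of `x` meets one of its forward images
`f ^ n`, `n ≥ 1`. -/
def nonwanderingSet (f : M → M) : Set M :=
  {x | ∀ U ∈ 𝓝 x, ∃ n : ℕ, 1 ≤ n ∧ (f^[n] '' U ∩ U).Nonempty}

/-- The `ω`-limit set of the forward orbit of `x` under `f`. -/
def omegaLimitSet (f : M → M) (x : M) : Set M :=
  omegaLimit atTop (fun (n : ℕ) (y : M) => f^[n] y) {x}

/-- `S` is a periodic orbit (possibly a fixed point). -/
def IsPeriodicOrbit (f : M → M) (S : Set M) : Prop :=
  ∃ p ∈ periodicPts f, S = range fun n : ℕ => f^[n] p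

/-- The return map at a periodic point `p`: `f` iterated over the minimal period of `p`.
For a fixed point this is `f`. -/
def returnMap (f : M → M) (p : M) : M → M := f^[minimalPeriod f p]

/-- The stable manifold `W^s(p)` of a periodic point `p` of `f`, as a set: the points
whose orbit under the return map converges to `p`. -/
def stableSet (f : M → M) (p : M) : Set M :=
  {x | Tendsto (fun n : ℕ => (returnMap f p)^[n] x) atTop (𝓝 p)}

end Topological

section Differentiable

variable {E : Type*} [NormedAddCommGroup E] [NormedSpace ℝ E]
  {H : Type*} [TopologicalSpace H] (I : ModelWithCorners ℝ E H)
  {M : Type*} [TopologicalSpace M] [ChartedSpace H M]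

/-- The tangent space at `x ∈ W^s(p)` of the stable manifold, which is an injectively
immersed submanifold: it consists of the velocities at `x` of the `C¹` curves that lie in `W^s(p)`
and along which the convergence to `p` is locally uniform at the base point.  (Local uniformity
says that the curve is continuous for the intrinsic topology of `W^s(p)`, that is, that
some iterate carries a piece of it around `x` into a given local stable manifold of `p`.) -/
def stableTangent (f : M → M) (p x : M) : Submodule ℝ (TangentSpace I x) :=
  Submodule.span ℝ {v | ∃ γ : ℝ → M, ContMDiff 𝓘(ℝ, ℝ) I 1 γ ∧ γ 0 = x ∧
    (∀ t, γ t ∈ stableSet f p) ∧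
    Tendsto (fun z : ℕ × ℝ => (returnMap f p)^[z.1] (γ z.2)) (atTop ×ˢ 𝓝 0) (𝓝 p) ∧
    (mfderiv 𝓘(ℝ, ℝ) I γ 0 (1 : ℝ) : E) = v}

/-- The derivative at a periodic point `p` of the return map, as an endomorphism of the tangent
space at `p` (which is the model vector space `E`). -/
def returnDeriv (f : M → M) (p : M) : E →L[ℝ] E := mfderiv I I (returnMap f p) p

variable [FiniteDimensional ℝ E]

/-- The multipliers of a periodic point `p`: the complex eigenvalues of the derivative at `p`
of the return map, an endomorphism of the tangent space at `p`. -/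
def multipliers (f : M → M) (p : M) : Set ℂ :=
  {z | Polynomial.aeval z (returnDeriv I f p : E →ₗ[ℝ] E).charpoly = 0}

/-- A periodic point is hyperbolic if no multiplier lies on the unit circle. -/
def IsHyperbolicPeriodicPt (f : M → M) (p : M) : Prop :=
  p ∈ periodicPts f ∧ ∀ z ∈ multipliers I f p, ‖z‖ ≠ 1

/-- A hyperbolic fixed point all of whose multipliers lie outside the closed unit disc. -/
def IsSource (f : M → M) (p : M) : Prop :=
  IsFixedPt f p ∧ IsHyperbolicPeriodicPt I f p ∧ ∀ z ∈ multipliers I f p, 1 < ‖z‖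

/-- A hyperbolic fixed point all of whose multipliers lie inside the open unit disc. -/
def IsSink (f : M → M) (p : M) : Prop :=
  IsFixedPt f p ∧ IsHyperbolicPeriodicPt I f p ∧ ∀ z ∈ multipliers I f p, ‖z‖ < 1

/-- A hyperbolic fixed point with multipliers both inside and outside the unit circle. -/
def IsSaddle (f : M → M) (p : M) : Prop :=
  IsFixedPt f p ∧ IsHyperbolicPeriodicPt I f p ∧
    (∃ z ∈ multipliers I f p, ‖z‖ < 1) ∧ ∃ z ∈ multipliers I f p, 1 < ‖z‖

/-- A Morse–Smale diffeomorphism of a compact smooth manifold.  The unstable manifold of `q` for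
`f` is the stable manifold of `q` for `f⁻¹`. -/
structure IsMorseSmale [IsManifold I ∞ M] [BoundarylessManifold I M] [CompactSpace M]
    [T2Space M] (f : M ≃ₘ^1⟮I, I⟯ M) : Prop where
  finite_nonwandering : (nonwanderingSet f).Finite
  hyperbolic : ∀ p ∈ nonwanderingSet f, IsHyperbolicPeriodicPt I f p
  limit_sets : ∀ x, IsPeriodicOrbit f (omegaLimitSet f x) ∧
    IsPeriodicOrbit f (omegaLimitSet f.symm x)
  transverse : ∀ p ∈ periodicPts f, ∀ q ∈ periodicPts f,
    ∀ x ∈ stableSet f p ∩ stableSet f.symm q,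
      stableTangent I f p x ⊔ stableTangent I f.symm q x = ⊤

end Differentiable

/-! ### The synchronisation map -/

/-- The torus `ℝ² / (2πℤ)²`. -/
abbrev Torus : Type := AddCircle (2 * π) × AddCircle (2 * π)

/-- The model with corners (without boundary) of the torus, with model space `ℝ × ℝ`. -/
abbrev torusModel : ModelWithCorners ℝ (ℝ × ℝ) (ModelProd ℝ ℝ) := 𝓘(ℝ, ℝ).prod 𝓘(ℝ, ℝ)

/-- The point of the torus with coordinates `(x, y)` modulo `2π`. -/
def torusPt (x y : ℝ) : Torus := ((x : AddCircle (2 * π)), (y : AddCircle (2 * π)))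

/-- The sine function on `ℝ / 2πℤ`. -/
def circleSin : AddCircle (2 * π) → ℝ := Real.sin_periodic.lift

/-- The map of the torus induced by
`(x, y) ↦ (x + 2a sin x + a sin y + a sin (x - y), y + a sin x + 2a sin y + a sin (y - x))`. -/
def syncMap (a : ℝ) (z : Torus) : Torus :=
  (z.1 + ((2 * a * circleSin z.1 + a * circleSin z.2 + a * circleSin (z.1 - z.2) : ℝ) :
      AddCircle (2 * π)),
   z.2 + ((a * circleSin z.1 + 2 * a * circleSin z.2 + a * circleSin (z.2 - z.1) : ℝ) :
      AddCircle (2 * π)))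

theorem syncMap_torusPt (a x y : ℝ) :
    syncMap a (torusPt x y) =
      torusPt (x + 2 * a * Real.sin x + a * Real.sin y + a * Real.sin (x - y))
        (y + a * Real.sin x + 2 * a * Real.sin y + a * Real.sin (y - x)) := by
  have h : ∀ t : ℝ, circleSin (t : AddCircle (2 * π)) = Real.sin t := fun t =>
    Function.Periodic.lift_coe _ t
  simp only [syncMap, torusPt, ← AddCircle.coe_sub, h, ← AddCircle.coe_add, add_assoc]

end

/-! ### Homeomorphisms with a strict Lyapunov function -/

/-! The map is a step of gradient descent. Put `V(x, y) = cos x + cos y + cos (x - y)`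
(`syncPotential`) and `Q(d) = d₁² + d₂² + (d₁ - d₂)²`. The displacement of `syncMap a` is `-3a`
times the gradient of `V` for the metric `Q`, and `|D²V(d, d)| ≤ Q(d)` everywhere. So the step size
`3a < 1` stays below the inverse of the Hessian bound, with two consequences.

The displacement of the lift is `3a`-Lipschitz for the norm `√Q` (`coupling_bound`), so the lift is
the identity plus a contraction, hence a diffeomorphism of the plane; it commutes with the periods
and descends (`exists_diffeomorph_syncMap`).

Moreover `V` decreases strictly off the critical points (`syncPotential_syncMap_le`). A strict
Lyapunov function makes every nonwandering or periodic point fixed, and with finitely many fixed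
points every orbit converges to one of them (`IsStrictLyapunov.exists_tendsto`). Applied to the
inverse with `-V`, this gives the `α`-limits. The critical points are found by trigonometry
(`Real.Angle.eq_of_sin_eq`), their multipliers from trace and determinant.

For transversality, `V` equals `3` at the source, `-1` at all three saddles and `-3/2` at the sinks.
At a point attracted to a sink, or issuing from the source, one of the two tangent spaces is
everything. Otherwise the orbit would join two saddles of equal potential, so it is constant; at a
saddle, two explicit invariant lines give the stable and unstable directions (`transverse_saddles`).
-/

theorem isPeriodicOrbit_singleton {M : Type*} {f : M → M} {p : M} (hp : IsFixedPt f p) :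
    IsPeriodicOrbit f {p} :=
  ⟨p, ⟨1, one_pos, hp⟩, by simp [fun n => (hp.iterate n).eq]⟩

theorem MapClusterPt.eq_of_tendsto {X α : Type*} [TopologicalSpace X] [T2Space X] {F : Filter α}
    {u : α → X} {x y : X} (hx : MapClusterPt x F u) (hy : Tendsto u F (𝓝 y)) : x = y :=
  have : (𝓝 x ⊓ 𝓝 y).NeBot := ClusterPt.mono hx hy
  eq_of_nhds_neBot this

section Lyapunov

variable {M : Type*} [TopologicalSpace M]

/-- A continuous function that decreases strictly along the non-constant orbits of `f`. -/
structure IsStrictLyapunov (f : M → M) (V : M → ℝ) : Prop where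
  continuous_map : Continuous f
  continuous : Continuous V
  lt_of_not_isFixedPt : ∀ x, ¬ IsFixedPt f x → V (f x) < V x

namespace IsStrictLyapunov

variable {f : M → M} {V : M → ℝ} (h : IsStrictLyapunov f V)
include h

theorem apply_le (x : M) : V (f x) ≤ V x := by
  by_cases hx : IsFixedPt f x
  · rw [hx]
  · exact (h.lt_of_not_isFixedPt x hx).le

theorem antitone_iterate (x : M) : Antitone fun n : ℕ => V (f^[n] x) :=
  antitone_nat_of_succ_le fun n => by
    rw [iterate_succ_apply']
    exact h.apply_le _

theorem limit_le {x p : M} (hp : Tendsto (fun n : ℕ => f^[n] x) atTop (𝓝 p)) : V p ≤ V x :=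
  (h.antitone_iterate x).le_of_tendsto ((h.continuous.tendsto p).comp hp) 0

theorem isFixedPt_of_le_limit {x p : M} (hp : Tendsto (fun n : ℕ => f^[n] x) atTop (𝓝 p))
    (hV : V x ≤ V p) : IsFixedPt f x := by
  by_contra hx
  have h1 := (h.antitone_iterate x).le_of_tendsto ((h.continuous.tendsto p).comp hp) 1
  exact absurd (h.lt_of_not_isFixedPt x hx) (not_lt.2 (hV.trans h1))

theorem nonwanderingSet_eq : nonwanderingSet f = fixedPoints f := by
  ext x
  constructor
  · intro hx
    by_contra hfix
    obtain ⟨c, hc1, hc2⟩ := exists_between (h.lt_of_not_isFixedPt x hfix)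
    -- No orbit returns to this neighbourhood: one step takes `V` below `c`, where it remains.
    have hU : {y | V (f y) < c ∧ c < V y} ∈ 𝓝 x :=
      ((h.continuous.comp h.continuous_map).continuousAt.eventually_lt_const hc1).and
        (h.continuous.continuousAt.eventually_const_lt hc2)
    obtain ⟨n, hn, _, ⟨y, hy, rfl⟩, hy'⟩ := hx _ hU
    have := h.antitone_iterate y hn
    simp only [iterate_one, mem_ofPred_eq] at this hy hy'
    linarith [hy.1, hy'.2]
  · intro hx U hU
    exact ⟨1, le_rfl, x, ⟨x, mem_of_mem_nhds hU, hx⟩, mem_of_mem_nhds hU⟩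

theorem isFixedPt_of_mem_periodicPts {x : M} (hx : x ∈ periodicPts f) : IsFixedPt f x := by
  obtain ⟨n, hn, hx⟩ := hx
  by_contra hfix
  have h1 := h.antitone_iterate x hn
  have h2 : f^[n] x = x := hx
  simp only [Nat.succ_eq_add_one, zero_add, iterate_one, h2] at h1
  exact absurd (h.lt_of_not_isFixedPt x hfix) (not_lt.2 h1)

/-- LaSalle's principle: `V` converges along the orbit, so it takes the same value at all cluster
points, and `f q` is a cluster point together with `q`. -/
theorem isFixedPt_of_mapClusterPt [CompactSpace M] {x q : M}
    (hq : MapClusterPt q atTop fun n : ℕ => f^[n] x) : IsFixedPt f q := by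
  obtain ⟨l, hl⟩ : ∃ l, Tendsto (fun n : ℕ => V (f^[n] x)) atTop (𝓝 l) := by
    refine ⟨_, tendsto_atTop_ciInf (h.antitone_iterate x) ?_⟩
    exact (isCompact_range h.continuous).bddBelow.mono
      (range_subset_iff.2 fun n => mem_range_self _)
  have hcl : ∀ y, MapClusterPt y atTop (fun n : ℕ => f^[n] x) → V y = l := fun y hy =>
    (hy.continuousAt_comp h.continuous.continuousAt).eq_of_tendsto hl
  have hfq : MapClusterPt (f q) atTop fun n : ℕ => f^[n] x := by
    have h1 := hq.continuousAt_comp h.continuous_map.continuousAt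
    refine MapClusterPt.of_comp (tendsto_add_atTop_nat 1) ?_
    convert h1 using 1
    exact funext fun n => iterate_succ_apply' f n x
  by_contra hfix
  exact (h.lt_of_not_isFixedPt q hfix).ne ((hcl _ hfq).trans (hcl _ hq).symm)

/-- If there are finitely many fixed points, every orbit converges to one of them. -/
theorem exists_tendsto [CompactSpace M] [T2Space M] (hfin : (fixedPoints f).Finite) (x : M) :
    ∃ p, IsFixedPt f p ∧ Tendsto (fun n : ℕ => f^[n] x) atTop (𝓝 p) := by
  obtain ⟨p, hp⟩ : ∃ p, MapClusterPt p atTop fun n : ℕ => f^[n] x :=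
    exists_clusterPt_of_compactSpace _
  have hpf := h.isFixedPt_of_mapClusterPt hp
  refine ⟨p, hpf, ?_⟩
  have hiso : ∀ᶠ y in 𝓝 p, y ∈ fixedPoints f → y = p := by
    have := (hfin.sdiff (t := {p})).isClosed.isOpen_compl.mem_nhds (x := p) (by simp)
    filter_upwards [this] with y hy hyf
    by_contra hne
    exact hy ⟨hyf, hne⟩
  refine (closed_nhds_basis p).tendsto_right_iff.2 fun K hK => ?_
  -- `C` is a closed neighbourhood of `p`, inside `K`, with no other fixed point.
  obtain ⟨C, ⟨hC, hCc⟩, hCK⟩ := (closed_nhds_basis p).mem_iff.1 (inter_mem hK.1 hiso)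
  have hint : interior C ∩ f ⁻¹' interior C ∈ 𝓝 p := by
    refine inter_mem (interior_mem_nhds.2 hC) (h.continuous_map.continuousAt.preimage_mem_nhds ?_)
    rw [hpf]
    exact interior_mem_nhds.2 hC
  -- The removed set is a neighbourhood of `p`, so the compact remainder holds no fixed point, hence
  -- no cluster point. From some time on, an orbit point in `C` has its image in `C`; since the
  -- orbit visits `C` at arbitrarily late times, it is trapped there.
  have hev : ∀ᶠ n in atTop, f^[n] x ∉ C \ (interior C ∩ f ⁻¹' interior C) := by
    by_contra hcon
    have hcomp : IsCompact (C \ (interior C ∩ f ⁻¹' interior C)) :=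
      (hCc.sdiff (isOpen_interior.inter (isOpen_interior.preimage h.continuous_map))).isCompact
    obtain ⟨q, hqC, hq⟩ := hcomp.exists_mapClusterPt_of_frequently
      (f := fun n : ℕ => f^[n] x) (l := atTop) (by
        rw [not_eventually] at hcon
        exact hcon.mono fun n hn => not_not.1 hn)
    have := (hCK hqC.1).2 (h.isFixedPt_of_mapClusterPt hq)
    exact hqC.2 (this ▸ mem_of_mem_nhds hint)
  obtain ⟨N, hN⟩ := eventually_atTop.1 hev
  obtain ⟨m, hm, hmC⟩ := (frequently_atTop.1 (hp.frequently hC)) N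
  filter_upwards [eventually_ge_atTop m] with n hn
  refine (hCK ?_).1
  induction n, hn using Nat.le_induction with
  | base => exact hmC
  | succ n hn ih =>
    have := hN n (hm.trans hn)
    rw [iterate_succ_apply']
    by_contra hcon
    exact this ⟨ih, fun hh => hcon (interior_subset hh.2)⟩

end IsStrictLyapunov

/-! ### Limit sets of convergent orbits, and uniform attraction -/

theorem omegaLimitSet_eq_singleton [T2Space M] {f : M → M} {x p : M}
    (hp : Tendsto (fun n : ℕ => f^[n] x) atTop (𝓝 p)) : omegaLimitSet f x = {p} := by
  ext y
  simp only [omegaLimitSet, mem_omegaLimit_iff_frequently, singleton_inter_nonempty,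
    mem_singleton_iff]
  constructor
  · intro hy
    have : MapClusterPt y atTop fun n : ℕ => f^[n] x := mapClusterPt_iff_frequently.2 hy
    exact this.eq_of_tendsto hp
  · rintro rfl n hn
    exact (hp.eventually hn).frequently

/-- The orbits of the points of some neighbourhood of `x` converge to `p`, uniformly. -/
def AttractedNear (f : M → M) (p x : M) : Prop :=
  ∃ U ∈ 𝓝 x, Tendsto (fun z : ℕ × M => f^[z.1] z.2) (atTop ×ˢ 𝓟 U) (𝓝 p)

/-- Some iterate `f^[m]` carries a neighbourhood of `x` into the uniformly attracted neighbourhood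
of `p`, and a shift of time by `m` does not affect the limit. -/
theorem AttractedNear.of_tendsto {f : M → M} (hf : Continuous f) {p x : M}
    (h : AttractedNear f p p) (hx : Tendsto (fun n : ℕ => f^[n] x) atTop (𝓝 p)) :
    AttractedNear f p x := by
  obtain ⟨U, hU, hlim⟩ := h
  obtain ⟨m, hm⟩ := (hx.eventually (interior_mem_nhds.2 hU)).exists
  refine ⟨f^[m] ⁻¹' U, (hf.iterate m).continuousAt.preimage_mem_nhds
    (mem_interior_iff_mem_nhds.1 hm), ?_⟩
  have h1 : Tendsto (fun z : ℕ × M => (z.1 - m, f^[m] z.2)) (atTop ×ˢ 𝓟 (f^[m] ⁻¹' U))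
      (atTop ×ˢ 𝓟 U) := by
    refine ((tendsto_sub_atTop_nat m).comp tendsto_fst).prodMk ?_
    refine tendsto_principal.2 ?_
    filter_upwards [tendsto_snd.eventually (mem_principal_self _)] with z hz using hz
  refine (hlim.comp h1).congr' ?_
  filter_upwards [tendsto_fst.eventually (eventually_ge_atTop m)] with z hz
  simp only [comp_apply]
  rw [← iterate_add_apply, Nat.sub_add_cancel hz]

end Lyapunov

/-- A map is a contraction near a fixed point at which its derivative is a homothety of ratio less
than one. -/
theorem attractedNear_of_hasFDerivAt {E : Type*} [NormedAddCommGroup E] [NormedSpace ℝ E]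
    {h : E → E} {p : E} {c : ℝ} (hc : |c| < 1) (hp : h p = p)
    (hd : HasFDerivAt h (c • ContinuousLinearMap.id ℝ E) p) : AttractedNear h p p := by
  -- The gap `k - |c|` absorbs the error of the linear approximation.
  obtain ⟨k, hk, hk1⟩ := exists_between hc
  have hk0 : 0 ≤ k := (abs_nonneg c).trans hk.le
  have hev : ∀ᶠ z in 𝓝 p, ‖h z - p‖ ≤ k * ‖z - p‖ := by
    filter_upwards [hd.isLittleO.def (sub_pos.2 hk)] with z hz
    have h1 : h z - p = (h z - h p - (c • ContinuousLinearMap.id ℝ E) (z - p)) + c • (z - p) := by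
      simp [hp]
    rw [h1]
    refine (norm_add_le _ _).trans ?_
    rw [norm_smul, Real.norm_eq_abs]
    linarith
  obtain ⟨r, hr, hball⟩ := Metric.eventually_nhds_iff_ball.1 hev
  have hit : ∀ n : ℕ, ∀ z ∈ Metric.ball p r, ‖h^[n] z - p‖ ≤ k ^ n * ‖z - p‖ := by
    intro n
    induction n with
    | zero => simp
    | succ n ih =>
      intro z hz
      have hz' := hball z hz
      have hzr : ‖z - p‖ < r := by simpa [dist_eq_norm] using hz
      rw [iterate_succ_apply, pow_succ, mul_assoc]
      refine (ih _ ?_).trans (by gcongr)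
      rw [mem_ball_iff_norm]
      nlinarith [norm_nonneg (z - p)]
  refine ⟨Metric.ball p r, Metric.ball_mem_nhds p hr, ?_⟩
  rw [tendsto_iff_norm_sub_tendsto_zero]
  have hlim : Tendsto (fun z : ℕ × E => k ^ z.1 * r) (atTop ×ˢ 𝓟 (Metric.ball p r)) (𝓝 0) := by
    simpa using ((tendsto_pow_atTop_nhds_zero_of_lt_one hk0 hk1).comp tendsto_fst).mul_const r
  refine squeeze_zero' (Eventually.of_forall fun _ => norm_nonneg _) ?_ hlim
  filter_upwards [tendsto_snd.eventually (mem_principal_self (Metric.ball p r))] with z hz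
  refine (hit _ _ hz).trans ?_
  have hzr : ‖z.2 - p‖ < r := by simpa [dist_eq_norm] using hz
  gcongr

/-- `L` need not be open here, so this also applies to an invariant line mapped into the torus. -/
theorem AttractedNear.tendsto_of_semiconj {X M : Type*} [TopologicalSpace X] [TopologicalSpace M]
    {h : X → X} {f : M → M} {L : X → M} (hL : Continuous L) (hf : Semiconj L h f) {p : X}
    (hp : AttractedNear h p p) :
    ∃ U ∈ 𝓝 p, Tendsto (fun z : ℕ × X => f^[z.1] (L z.2)) (atTop ×ˢ 𝓟 U) (𝓝 (L p)) := by
  obtain ⟨U, hU, hlim⟩ := hp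
  refine ⟨U, hU, ((hL.tendsto p).comp hlim).congr fun z => ?_⟩
  exact (hf.iterate_right z.1).eq z.2

theorem AttractedNear.of_semiconj {X M : Type*} [TopologicalSpace X] [TopologicalSpace M]
    {h : X → X} {f : M → M} {L : X → M} (hL : Continuous L) (hLo : IsOpenMap L)
    (hf : Semiconj L h f) {p : X} (hp : AttractedNear h p p) : AttractedNear f (L p) (L p) := by
  obtain ⟨U, hU, hlim⟩ := hp.tendsto_of_semiconj hL hf
  refine ⟨L '' U, hLo.image_mem_nhds hU, ?_⟩
  intro W hW
  obtain ⟨A, hA, B, hB, hAB⟩ := mem_prod_iff.1 (hlim hW)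
  refine mem_prod_iff.2 ⟨A, hA, L '' U, mem_principal_self _, ?_⟩
  rintro ⟨n, _⟩ ⟨hn, y, hy, rfl⟩
  exact hAB (mk_mem_prod hn (hB hy))

/-! ### Smooth maps of the torus that lift to the plane -/

namespace AddCircleManifold

variable (p : ℝ) [hp : Fact (0 < p)]

theorem contMDiff_coe (n : WithTop ℕ∞) :
    ContMDiff 𝓘(ℝ, ℝ) 𝓘(ℝ, ℝ) n ((↑) : ℝ → AddCircle p) := by
  intro t
  have hmem : (AddCircle.openPartialHomeomorphCoe p (t - p / 2)).symm ∈
      IsManifold.maximalAtlas 𝓘(ℝ, ℝ) n (AddCircle p) :=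
    IsManifold.subset_maximalAtlas (mem_range_self _)
  have hpos := hp.out
  exact contMDiffAt_symm_of_mem_maximalAtlas (x := t) hmem
    (show t ∈ Ioo (t - p / 2) (t - p / 2 + p) from ⟨by linarith, by linarith⟩)

/-- In the preferred chart the projection is locally a translation by a period. Derivatives on the
torus can therefore be read off from lifts without any change of coordinates. -/
theorem hasMFDerivAt_coe (t : ℝ) :
    HasMFDerivAt 𝓘(ℝ, ℝ) 𝓘(ℝ, ℝ) ((↑) : ℝ → AddCircle p) t (ContinuousLinearMap.id ℝ ℝ) := by
  refine ⟨(AddCircle.continuous_mk' p).continuousAt, ?_⟩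
  set e := AddCircle.openPartialHomeomorphCoe p
    ((AddCircle.equivIco p 0 (t : AddCircle p) : ℝ) - p / 2) with he
  have hchart : (t : AddCircle p) ∈ e.target := mem_chart_source ℝ (t : AddCircle p)
  set s : ℝ := e.symm (t : AddCircle p) with hs
  have hs1 : s ∈ e.source := e.map_target hchart
  have hs2 : (s : AddCircle p) = t := e.right_inv hchart
  have hcont : ContinuousAt (fun u : ℝ => u + (s - t)) t := by fun_prop
  have hev : ∀ᶠ u in 𝓝 t, u + (s - t) ∈ e.source :=
    hcont.eventually (e.open_source.mem_nhds (by simpa using hs1))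
  have key : writtenInExtChartAt 𝓘(ℝ, ℝ) 𝓘(ℝ, ℝ) t ((↑) : ℝ → AddCircle p) =ᶠ[𝓝 t]
      fun u : ℝ => u + (s - t) := by
    filter_upwards [hev] with u hu
    have h1 : ((u + (s - t) : ℝ) : AddCircle p) = u := by
      rw [AddCircle.coe_add, AddCircle.coe_sub, hs2, sub_self, add_zero]
    have h2 : e.symm ((u + (s - t) : ℝ) : AddCircle p) = u + (s - t) := e.left_inv hu
    rw [h1] at h2
    exact h2
  have hd : HasFDerivAt (fun u : ℝ => u + (s - t)) (ContinuousLinearMap.id ℝ ℝ) t :=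
    (hasFDerivAt_id t).add_const _
  exact (hd.congr_of_eventuallyEq key).hasFDerivWithinAt (s := range 𝓘(ℝ, ℝ))

end AddCircleManifold

/-- The projection of the plane onto the torus. -/
noncomputable def torusProj (z : ℝ × ℝ) : Torus := torusPt z.1 z.2

theorem continuous_torusProj : Continuous torusProj :=
  ((AddCircle.continuous_mk' _).comp continuous_fst).prodMk
    ((AddCircle.continuous_mk' _).comp continuous_snd)

theorem isOpenMap_torusProj : IsOpenMap torusProj :=
  IsOpenMap.prodMap QuotientAddGroup.isOpenMap_coe QuotientAddGroup.isOpenMap_coe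

theorem surjective_torusProj : Surjective torusProj :=
  Surjective.prodMap QuotientAddGroup.mk_surjective QuotientAddGroup.mk_surjective

theorem torusProj_eq_iff {z w : ℝ × ℝ} : torusProj z = torusProj w ↔
    ∃ m n : ℤ, z = w + (m * (2 * π), n * (2 * π)) := by
  have key : ∀ s t : ℝ, (s : AddCircle (2 * π)) = t ↔ ∃ m : ℤ, s = t + m * (2 * π) := by
    intro s t
    rw [← sub_eq_zero, ← AddCircle.coe_sub, AddCircle.coe_eq_zero_iff]
    simp only [zsmul_eq_mul, eq_sub_iff_add_eq', eq_comm (a := s)]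
  simp only [torusProj, torusPt, Prod.ext_iff, key]
  simp

theorem contMDiff_torusProj : ContMDiff 𝓘(ℝ, ℝ × ℝ) torusModel 1 torusProj :=
  ((AddCircleManifold.contMDiff_coe _ 1).comp contDiff_fst.contMDiff).prodMk
    ((AddCircleManifold.contMDiff_coe _ 1).comp contDiff_snd.contMDiff)

theorem hasMFDerivAt_torusProj (z : ℝ × ℝ) :
    HasMFDerivAt 𝓘(ℝ, ℝ × ℝ) torusModel torusProj z (ContinuousLinearMap.id ℝ (ℝ × ℝ)) := by
  have h1 := (AddCircleManifold.hasMFDerivAt_coe (2 * π) z.1).comp z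
    (hasFDerivAt_fst (𝕜 := ℝ) (E := ℝ) (F := ℝ) (p := z)).hasMFDerivAt
  have h2 := (AddCircleManifold.hasMFDerivAt_coe (2 * π) z.2).comp z
    (hasFDerivAt_snd (𝕜 := ℝ) (E := ℝ) (F := ℝ) (p := z)).hasMFDerivAt
  exact h1.prodMk h2

/-- The projection has smooth local sections. -/
theorem exists_contMDiffAt_section (z : ℝ × ℝ) : ∃ σ : Torus → ℝ × ℝ,
    ContMDiffAt torusModel 𝓘(ℝ, ℝ × ℝ) 1 σ (torusProj z) ∧
    (∀ᶠ w in 𝓝 (torusProj z), torusProj (σ w) = w) ∧ ∀ᶠ w in 𝓝 z, σ (torusProj w) = w := by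
  set e : ℝ → OpenPartialHomeomorph ℝ (AddCircle (2 * π)) := fun t =>
    AddCircle.openPartialHomeomorphCoe (2 * π) (t - π) with he
  have hmem : ∀ t, (e t).symm ∈ IsManifold.maximalAtlas 𝓘(ℝ, ℝ) 1 (AddCircle (2 * π)) :=
    fun t => IsManifold.subset_maximalAtlas (mem_range_self _)
  have hsrc : ∀ t : ℝ, t ∈ (e t).source := fun t =>
    show t ∈ Ioo (t - π) (t - π + 2 * π) from ⟨by linarith [Real.pi_pos], by linarith [Real.pi_pos]⟩
  have htgt : ∀ t : ℝ, (t : AddCircle (2 * π)) ∈ (e t).target := fun t => (e t).map_source (hsrc t)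
  have hsm : ∀ t : ℝ, ContMDiffAt 𝓘(ℝ, ℝ) 𝓘(ℝ, ℝ) 1 (e t).symm (t : AddCircle (2 * π)) :=
    fun t => contMDiffAt_of_mem_maximalAtlas (hmem t) (htgt t)
  refine ⟨fun w => ((e z.1).symm w.1, (e z.2).symm w.2), ?_, ?_, ?_⟩
  · refine ContMDiffAt.prodMk_space ?_ ?_
    · exact ContMDiffAt.comp (torusProj z) (hsm z.1) contMDiffAt_fst
    · exact ContMDiffAt.comp (torusProj z) (hsm z.2) contMDiffAt_snd
  · have h1 : ∀ᶠ w in 𝓝 (torusProj z), w.1 ∈ (e z.1).target :=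
      continuous_fst.continuousAt.eventually ((e z.1).open_target.mem_nhds (htgt z.1))
    have h2 : ∀ᶠ w in 𝓝 (torusProj z), w.2 ∈ (e z.2).target :=
      continuous_snd.continuousAt.eventually ((e z.2).open_target.mem_nhds (htgt z.2))
    filter_upwards [h1, h2] with w hw1 hw2
    exact Prod.ext ((e z.1).right_inv hw1) ((e z.2).right_inv hw2)
  · have h1 : ∀ᶠ w in 𝓝 z, w.1 ∈ (e z.1).source :=
      continuous_fst.continuousAt.eventually ((e z.1).open_source.mem_nhds (hsrc z.1))
    have h2 : ∀ᶠ w in 𝓝 z, w.2 ∈ (e z.2).source :=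
      continuous_snd.continuousAt.eventually ((e z.2).open_source.mem_nhds (hsrc z.2))
    filter_upwards [h1, h2] with w hw1 hw2
    exact Prod.ext ((e z.1).left_inv hw1) ((e z.2).left_inv hw2)

section Lift

variable {F : ℝ × ℝ → ℝ × ℝ} {f : Torus → Torus} (hf : Semiconj torusProj F f)
include hf

theorem contMDiff_of_semiconj (hF : ContDiff ℝ 1 F) : ContMDiff torusModel torusModel 1 f := by
  intro w
  obtain ⟨z, rfl⟩ := surjective_torusProj w
  obtain ⟨σ, hσ, hσ1, hσ2⟩ := exists_contMDiffAt_section z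
  have h1 : ContMDiffAt torusModel torusModel 1 (torusProj ∘ F ∘ σ) (torusProj z) :=
    (contMDiff_torusProj.comp hF.contMDiff).contMDiffAt.comp _ hσ
  refine h1.congr_of_eventuallyEq ?_
  filter_upwards [hσ1] with w hw
  rw [comp_apply, comp_apply, hf.eq, hw]

theorem mfderiv_of_semiconj (hF : ContDiff ℝ 1 F) {z : ℝ × ℝ} {A : ℝ × ℝ →L[ℝ] ℝ × ℝ}
    (hA : HasFDerivAt F A z) :
    (mfderiv torusModel torusModel f (torusProj z) : ℝ × ℝ →L[ℝ] ℝ × ℝ) = A := by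
  have h1 : HasMFDerivAt torusModel torusModel f (torusProj z)
      (mfderiv torusModel torusModel f (torusProj z)) :=
    ((contMDiff_of_semiconj hf hF).mdifferentiableAt one_ne_zero).hasMFDerivAt
  have h2 := h1.comp z (hasMFDerivAt_torusProj z)
  have h3 := (hasMFDerivAt_torusProj (F z)).comp z hA.hasMFDerivAt
  rw [← hf.comp_eq] at h2
  have h4 := hasMFDerivAt_unique h2 h3
  exact h4

theorem returnDeriv_of_semiconj (hF : ContDiff ℝ 1 F) {z : ℝ × ℝ} (hz : F z = z)
    {A : ℝ × ℝ →L[ℝ] ℝ × ℝ} (hA : HasFDerivAt F A z) :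
    returnDeriv torusModel f (torusProj z) = A := by
  have hfix : IsFixedPt f (torusProj z) := by
    rw [IsFixedPt, ← hf.eq, hz]
  have h1 : returnMap f (torusProj z) = f := by
    rw [returnMap, minimalPeriod_eq_one_iff_isFixedPt.2 hfix, iterate_one]
  rw [returnDeriv, h1]
  exact mfderiv_of_semiconj hf hF hA

end Lift

/-! ### Tangent vectors to stable manifolds -/

theorem returnMap_of_isFixedPt {M : Type*} {f : M → M} {p : M} (hp : IsFixedPt f p) :
    returnMap f p = f := by
  rw [returnMap, minimalPeriod_eq_one_iff_isFixedPt.2 hp, iterate_one]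

/-- The direction of a segment whose points converge uniformly to the fixed point `p` is tangent to
the stable manifold of `p`. -/
theorem mem_stableTangent {f : Torus → Torus} {p : Torus} (hp : IsFixedPt f p) {z v : ℝ × ℝ}
    {ε : ℝ} (hε : 0 < ε)
    (h : Tendsto (fun q : ℕ × ℝ => f^[q.1] (torusProj (z + q.2 • v)))
      (atTop ×ˢ 𝓟 (Icc (-ε) ε)) (𝓝 p)) :
    (show TangentSpace torusModel (torusProj z) from v) ∈
      stableTangent torusModel f p (torusProj z) := by
  -- The curves in `stableTangent` are defined on all of `ℝ` and must stay in the stable set. The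
  -- parameter `ε sin t` confines them to the segment; its speed `ε` at `0` is divided out at the
  -- end.
  have hs : ∀ t, ε * Real.sin t ∈ Icc (-ε) ε := fun t =>
    ⟨by nlinarith [Real.neg_one_le_sin t], by nlinarith [Real.sin_le_one t]⟩
  have hcd : ContDiff ℝ 1 fun t : ℝ => z + (ε * Real.sin t) • v := by fun_prop
  have hder : HasFDerivAt (fun t : ℝ => z + (ε * Real.sin t) • v)
      (ContinuousLinearMap.toSpanSingleton ℝ (ε • v)) 0 := by
    have h1 : HasDerivAt (fun t : ℝ => ε * Real.sin t) ε 0 := by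
      simpa using (Real.hasDerivAt_sin 0).const_mul ε
    have h2 := (h1.smul_const v).const_add z
    exact h2.hasFDerivAt
  have hmem : (show TangentSpace torusModel (torusProj z) from ε • v) ∈
      stableTangent torusModel f p (torusProj z) := by
    refine Submodule.subset_span ⟨fun t => torusProj (z + (ε * Real.sin t) • v),
      contMDiff_torusProj.comp hcd.contMDiff, by simp, fun t => ?_, ?_, ?_⟩
    · rw [stableSet, returnMap_of_isFixedPt hp]
      exact h.comp (tendsto_id.prodMk (tendsto_principal.2 (Eventually.of_forall fun _ => hs t)))
    · rw [returnMap_of_isFixedPt hp]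
      exact h.comp (tendsto_fst.prodMk (tendsto_principal.2 (Eventually.of_forall fun q => hs q.2)))
    · have h1 := (hasMFDerivAt_torusProj (z + (ε * Real.sin 0) • v)).comp (0 : ℝ) hder.hasMFDerivAt
      have h2 := congrArg (fun A : ℝ →L[ℝ] ℝ × ℝ => A 1) h1.mfderiv
      refine Eq.trans h2 ?_
      exact one_smul ℝ (ε • v)
  have := Submodule.smul_mem _ ε⁻¹ hmem
  have h3 : ε⁻¹ • ε • v = v := inv_smul_smul₀ hε.ne' v
  exact h3 ▸ this

theorem mem_stableTangent_of_attractedNear {f : Torus → Torus} {p : Torus} (hp : IsFixedPt f p)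
    {z : ℝ × ℝ} (h : AttractedNear f p (torusProj z)) (v : ℝ × ℝ) :
    (show TangentSpace torusModel (torusProj z) from v) ∈
      stableTangent torusModel f p (torusProj z) := by
  obtain ⟨U, hU, hlim⟩ := h
  have hc : Continuous fun t : ℝ => torusProj (z + t • v) :=
    continuous_torusProj.comp (by fun_prop)
  have hev : ∀ᶠ t : ℝ in 𝓝 0, torusProj (z + t • v) ∈ U :=
    hc.continuousAt.eventually (by simpa using hU)
  obtain ⟨ε, hε, hball⟩ := Metric.nhds_basis_closedBall.eventually_iff.1 hev
  refine mem_stableTangent hp hε ?_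
  refine hlim.comp (tendsto_fst.prodMk (tendsto_principal.2 ?_))
  filter_upwards [tendsto_snd.eventually (mem_principal_self _)] with q hq
  exact hball (by simpa [Real.closedBall_eq_Icc] using hq)

theorem stableTangent_eq_top {f : Torus → Torus} {p x : Torus} (hp : IsFixedPt f p)
    (h : AttractedNear f p x) : stableTangent torusModel f p x = ⊤ := by
  obtain ⟨z, rfl⟩ := surjective_torusProj x
  exact eq_top_iff.2 fun v _ => mem_stableTangent_of_attractedNear hp h v

/-- An invariant line through a fixed point on which the dynamics is contracting is tangent to the
stable manifold. -/
theorem mem_stableTangent_of_line {f : Torus → Torus} {z v : ℝ × ℝ} {h : ℝ → ℝ} {c : ℝ}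
    (hf : ∀ t : ℝ, f (torusProj (z + t • v)) = torusProj (z + h t • v)) (h0 : h 0 = 0)
    (hd : HasDerivAt h c 0) (hc : |c| < 1) :
    (show TangentSpace torusModel (torusProj z) from v) ∈
      stableTangent torusModel f (torusProj z) (torusProj z) := by
  have hp : IsFixedPt f (torusProj z) := by simpa [IsFixedPt, h0] using hf 0
  have hL : Continuous fun t : ℝ => torusProj (z + t • v) :=
    continuous_torusProj.comp (by fun_prop)
  have hatt : AttractedNear h 0 0 := by
    refine attractedNear_of_hasFDerivAt hc h0 (hd.hasFDerivAt.congr_fderiv ?_)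
    ext
    simp
  obtain ⟨U, hU, hlim⟩ := hatt.tendsto_of_semiconj hL (fun t => (hf t).symm)
  obtain ⟨ε, hε, hball⟩ := Metric.nhds_basis_closedBall.mem_iff.1 hU
  refine mem_stableTangent hp hε ?_
  simp only [zero_smul, add_zero] at hlim
  refine hlim.mono_left (prod_mono le_rfl (principal_mono.2 ?_))
  rwa [Real.closedBall_eq_Icc, zero_sub, zero_add] at hball

/-! ### The lift of the synchronisation map to the plane -/

/-- The lift of `syncMap a` to the plane. -/
noncomputable def syncLift (a : ℝ) (z : ℝ × ℝ) : ℝ × ℝ :=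
  (z.1 + 2 * a * Real.sin z.1 + a * Real.sin z.2 + a * Real.sin (z.1 - z.2),
    z.2 + a * Real.sin z.1 + 2 * a * Real.sin z.2 + a * Real.sin (z.2 - z.1))

theorem semiconj_syncLift (a : ℝ) : Semiconj torusProj (syncLift a) (syncMap a) :=
  fun z => (syncMap_torusPt a z.1 z.2).symm

/-- The linear map `v ↦ v + a (2 α v₁ + β v₂ + γ (v₁ - v₂), α v₁ + 2 β v₂ - γ (v₁ - v₂))`. -/
noncomputable def couplingMap (a α β γ : ℝ) : ℝ × ℝ →L[ℝ] ℝ × ℝ :=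
  ((1 + a * (2 * α + γ)) • ContinuousLinearMap.fst ℝ ℝ ℝ +
      (a * (β - γ)) • ContinuousLinearMap.snd ℝ ℝ ℝ).prod
    ((a * (α - γ)) • ContinuousLinearMap.fst ℝ ℝ ℝ +
      (1 + a * (2 * β + γ)) • ContinuousLinearMap.snd ℝ ℝ ℝ)

theorem couplingMap_apply (a α β γ : ℝ) (v : ℝ × ℝ) : couplingMap a α β γ v =
    ((1 + a * (2 * α + γ)) * v.1 + a * (β - γ) * v.2,
      a * (α - γ) * v.1 + (1 + a * (2 * β + γ)) * v.2) := rfl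

theorem hasFDerivAt_syncLift (a : ℝ) (z : ℝ × ℝ) :
    HasFDerivAt (syncLift a)
      (couplingMap a (Real.cos z.1) (Real.cos z.2) (Real.cos (z.1 - z.2))) z := by
  have h1 : HasFDerivAt (fun z : ℝ × ℝ => z.1) (ContinuousLinearMap.fst ℝ ℝ ℝ) z := hasFDerivAt_fst
  have h2 : HasFDerivAt (fun z : ℝ × ℝ => z.2) (ContinuousLinearMap.snd ℝ ℝ ℝ) z := hasFDerivAt_snd
  have h3 := h1.sin
  have h4 := h2.sin
  have h5 := (h1.sub h2).sin
  have h6 := (h2.sub h1).sin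
  refine ((((h1.add (h3.const_mul (2 * a))).add (h4.const_mul a)).add (h5.const_mul a)).prodMk
    (((h2.add (h3.const_mul a)).add (h4.const_mul (2 * a))).add (h6.const_mul a))).congr_fderiv ?_
  have hc : Real.cos (z.2 - z.1) = Real.cos (z.1 - z.2) := by rw [← Real.cos_neg, neg_sub]
  refine ContinuousLinearMap.ext fun v => ?_
  simp only [couplingMap_apply, ContinuousLinearMap.prod_apply, add_apply,
    smul_apply, sub_apply, ContinuousLinearMap.coe_fst',
    ContinuousLinearMap.coe_snd', smul_eq_mul, Pi.sub_apply, hc]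
  ext <;> simp only <;> ring

theorem contDiff_syncLift (a : ℝ) : ContDiff ℝ 1 (syncLift a) := by
  unfold syncLift
  fun_prop

/-- The left side equals `9a²(s² + t² + u²) - 3a²(s - t - u)²`. It serves with `s, t, u` as
differences of sines, for the map, and as cosines times components, for its derivative. -/
theorem coupling_bound {a d₁ d₂ s t u : ℝ} (hs : s ^ 2 ≤ d₁ ^ 2) (ht : t ^ 2 ≤ d₂ ^ 2)
    (hu : u ^ 2 ≤ (d₁ - d₂) ^ 2) :
    (a * (2 * s + t + u)) ^ 2 + (a * (s + 2 * t - u)) ^ 2 +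
        (a * (2 * s + t + u) - a * (s + 2 * t - u)) ^ 2 ≤
      (3 * a) ^ 2 * (d₁ ^ 2 + d₂ ^ 2 + (d₁ - d₂) ^ 2) := by
  have h1 : 0 ≤ a ^ 2 * (s - t - u) ^ 2 := by positivity
  have h2 := mul_le_mul_of_nonneg_left (add_le_add (add_le_add hs ht) hu) (sq_nonneg (3 * a))
  linarith

/-- A kernel vector `v` is the opposite of its own displacement, so `Q(v) ≤ 9a² Q(v)` with `9a² <
1`. -/
theorem injective_couplingMap {a α β γ : ℝ} (ha : 0 < a) (ha' : a < 1 / 3) (hα : |α| ≤ 1)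
    (hβ : |β| ≤ 1) (hγ : |γ| ≤ 1) : Injective (couplingMap a α β γ) := by
  have key : ∀ c d : ℝ, |c| ≤ 1 → (c * d) ^ 2 ≤ d ^ 2 := fun c d hc => by
    rw [mul_pow]
    exact mul_le_of_le_one_left (sq_nonneg d) ((sq_le_one_iff_abs_le_one c).2 hc)
  refine (injective_iff_map_eq_zero _).2 fun v hv => ?_
  rw [couplingMap_apply, Prod.ext_iff] at hv
  obtain ⟨h1, h2⟩ := hv
  simp only [Prod.fst_zero, Prod.snd_zero] at h1 h2
  have hb := coupling_bound (a := a) (key α v.1 hα) (key β v.2 hβ) (key γ (v.1 - v.2) hγ)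
  have e1 : a * (2 * (α * v.1) + β * v.2 + γ * (v.1 - v.2)) = -v.1 := by linarith
  have e2 : a * (α * v.1 + 2 * (β * v.2) - γ * (v.1 - v.2)) = -v.2 := by linarith
  rw [e1, e2] at hb
  have h9 : (3 * a) ^ 2 < 1 := by nlinarith
  have hN : v.1 ^ 2 + v.2 ^ 2 + (v.1 - v.2) ^ 2 ≤ 0 := by
    by_contra! hpos
    have := mul_lt_of_lt_one_left hpos h9
    linarith
  have z1 : v.1 = 0 := (pow_eq_zero_iff two_ne_zero).1 (le_antisymm
    (by linarith [sq_nonneg v.1, sq_nonneg v.2, sq_nonneg (v.1 - v.2)]) (sq_nonneg _))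
  have z2 : v.2 = 0 := (pow_eq_zero_iff two_ne_zero).1 (le_antisymm
    (by linarith [sq_nonneg v.1, sq_nonneg v.2, sq_nonneg (v.1 - v.2)]) (sq_nonneg _))
  exact Prod.ext z1 z2

theorem sin_sub_sin_sq_le (x y : ℝ) : (Real.sin x - Real.sin y) ^ 2 ≤ (x - y) ^ 2 := by
  have h : |Real.sin x - Real.sin y| ≤ |x - y| := by
    have := Real.lipschitzWith_sin.dist_le_mul x y
    simpa [Real.dist_eq] using this
  exact sq_le_sq.2 h

theorem exists_antilipschitzWith_syncLift {a : ℝ} (ha : 0 < a) (ha' : a < 1 / 3) :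
    ∃ K, AntilipschitzWith K (syncLift a) := by
  have hk : 0 < 1 - 3 * a := by linarith
  refine ⟨⟨3 / (1 - 3 * a), by positivity⟩, AntilipschitzWith.of_le_mul_dist fun z w => ?_⟩
  have hb := coupling_bound (a := a) (sin_sub_sin_sq_le z.1 w.1) (sin_sub_sin_sq_le z.2 w.2)
    (u := Real.sin (z.1 - z.2) - Real.sin (w.1 - w.2)) (by
      rw [show z.1 - w.1 - (z.2 - w.2) = (z.1 - z.2) - (w.1 - w.2) by ring]
      exact sin_sub_sin_sq_le _ _)
  have hz : Real.sin (z.2 - z.1) = -Real.sin (z.1 - z.2) := by rw [← Real.sin_neg, neg_sub]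
  have hw : Real.sin (w.2 - w.1) = -Real.sin (w.1 - w.2) := by rw [← Real.sin_neg, neg_sub]
  set e := syncLift a z - syncLift a w with he
  have e1 : a * (2 * (Real.sin z.1 - Real.sin w.1) + (Real.sin z.2 - Real.sin w.2) +
      (Real.sin (z.1 - z.2) - Real.sin (w.1 - w.2))) = e.1 - (z.1 - w.1) := by
    simp only [he, syncLift, Prod.fst_sub]
    ring
  have e2 : a * ((Real.sin z.1 - Real.sin w.1) + 2 * (Real.sin z.2 - Real.sin w.2) -
      (Real.sin (z.1 - z.2) - Real.sin (w.1 - w.2))) = e.2 - (z.2 - w.2) := by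
    simp only [he, syncLift, Prod.snd_sub, hz, hw]
    ring
  rw [e1, e2] at hb
  rw [dist_eq_norm, dist_eq_norm, ← he]
  have h1 : |e.1| ≤ ‖e‖ := norm_fst_le e
  have h2 : |e.2| ≤ ‖e‖ := norm_snd_le e
  have h1' := sq_le_sq' (abs_le.1 h1).1 (abs_le.1 h1).2
  have h2' := sq_le_sq' (abs_le.1 h2).1 (abs_le.1 h2).2
  generalize hd1 : z.1 - w.1 = d₁ at hb
  generalize hd2 : z.2 - w.2 = d₂ at hb
  generalize e.1 = e₁ at hb h1' h2'
  generalize e.2 = e₂ at hb h1' h2'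
  -- Summed over the three terms of `Q`, this replaces the triangle inequality for `√Q`: from `√Q(e
  -- - d) ≤ 3a √Q(d)` it yields `√Q(e) ≥ (1 - 3a) √Q(d)`.
  have key : ∀ x y : ℝ, 0 ≤ 3 * a * y ^ 2 - 3 * a * (1 - 3 * a) * x ^ 2 +
      (1 - 3 * a) * (y - x) ^ 2 := fun x y => by
    have : 3 * a * y ^ 2 - 3 * a * (1 - 3 * a) * x ^ 2 + (1 - 3 * a) * (y - x) ^ 2 =
      (y - (1 - 3 * a) * x) ^ 2 := by ring
    rw [this]
    positivity
  have hN : (1 - 3 * a) ^ 2 * (d₁ ^ 2 + d₂ ^ 2 + (d₁ - d₂) ^ 2) ≤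
      e₁ ^ 2 + e₂ ^ 2 + (e₁ - e₂) ^ 2 := by
    have h3 := mul_le_mul_of_nonneg_left hb hk.le
    have h4 := key d₁ e₁
    have h5 := key d₂ e₂
    have h6 := key (d₁ - d₂) (e₁ - e₂)
    refine le_of_mul_le_mul_left ?_ (show 0 < 3 * a by linarith)
    linarith
  -- In the sup norm `Q(e) ≤ 6‖e‖²`, rounded up to the square `9‖e‖²`.
  have hN' : (1 - 3 * a) ^ 2 * (d₁ ^ 2 + d₂ ^ 2 + (d₁ - d₂) ^ 2) ≤ (3 * ‖e‖) ^ 2 := by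
    linarith [sq_nonneg (e₁ + e₂), sq_nonneg ‖e‖]
  have hfin : ∀ d : ℝ, d ^ 2 ≤ d₁ ^ 2 + d₂ ^ 2 + (d₁ - d₂) ^ 2 →
      |d| ≤ 3 / (1 - 3 * a) * ‖e‖ := fun d hd => by
    rw [div_mul_eq_mul_div, le_div_iff₀ hk, mul_comm, ← abs_of_pos hk, ← abs_mul,
      ← abs_of_nonneg (show 0 ≤ 3 * ‖e‖ by positivity)]
    refine sq_le_sq.1 ?_
    rw [mul_pow]
    exact (mul_le_mul_of_nonneg_left hd (sq_nonneg _)).trans hN'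
  rw [Prod.norm_def, Prod.fst_sub, Prod.snd_sub, hd1, hd2]
  exact max_le (hfin _ (by linarith [sq_nonneg d₂, sq_nonneg (d₁ - d₂)]))
    (hfin _ (by linarith [sq_nonneg d₁, sq_nonneg (d₁ - d₂)]))

theorem uniformContinuous_syncLift (a : ℝ) : UniformContinuous (syncLift a) := by
  have h1 : UniformContinuous fun z : ℝ × ℝ => z.1 := uniformContinuous_fst
  have h2 : UniformContinuous fun z : ℝ × ℝ => z.2 := uniformContinuous_snd
  have hs : UniformContinuous Real.sin := Real.lipschitzWith_sin.uniformContinuous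
  exact (((h1.add ((hs.comp h1).const_mul' (2 * a))).add ((hs.comp h2).const_mul' a)).add
      ((hs.comp (h1.sub h2)).const_mul' a)).prodMk
    (((h2.add ((hs.comp h1).const_mul' a)).add ((hs.comp h2).const_mul' (2 * a))).add
      ((hs.comp (h2.sub h1)).const_mul' a))

/-- The lift is a `C¹` diffeomorphism of the plane. -/
theorem exists_homeomorph_syncLift {a : ℝ} (ha : 0 < a) (ha' : a < 1 / 3) :
    ∃ e : (ℝ × ℝ) ≃ₜ (ℝ × ℝ), (∀ z, e z = syncLift a z) ∧ ContDiff ℝ 1 e.symm := by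
  obtain ⟨K, hK⟩ := exists_antilipschitzWith_syncLift ha ha'
  have hc : Continuous (syncLift a) := (contDiff_syncLift a).continuous
  choose A hA using fun z : ℝ × ℝ => show ∃ A : (ℝ × ℝ) ≃L[ℝ] ℝ × ℝ,
      (A : ℝ × ℝ →L[ℝ] ℝ × ℝ) =
        couplingMap a (Real.cos z.1) (Real.cos z.2) (Real.cos (z.1 - z.2)) from
    ⟨(LinearEquiv.ofInjectiveEndo _ (injective_couplingMap ha ha' (Real.abs_cos_le_one _)
      (Real.abs_cos_le_one _) (Real.abs_cos_le_one _))).toContinuousLinearEquiv,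
      ContinuousLinearMap.ext fun _ => rfl⟩
  have hd : ∀ z, HasFDerivAt (syncLift a) (A z : ℝ × ℝ →L[ℝ] ℝ × ℝ) z := fun z =>
    (hA z).symm ▸ hasFDerivAt_syncLift a z
  have hopen : IsOpenMap (syncLift a) := isOpenMap_iff_nhds_le.2 fun z =>
    (((contDiff_syncLift a).contDiffAt.hasStrictFDerivAt' (hd z)
      one_ne_zero).map_nhds_eq_of_equiv).ge
  -- The range is closed by the antilipschitz bound and open by the inverse function theorem, and
  -- the plane is connected.
  have hsurj : Surjective (syncLift a) := by
    rw [← range_eq_univ]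
    exact IsClopen.eq_univ
      ⟨hK.isClosed_range (uniformContinuous_syncLift a), hopen.isOpen_range⟩ (range_nonempty _)
  let e := (Equiv.ofBijective _ ⟨hK.injective, hsurj⟩).toHomeomorphOfContinuousOpen hc hopen
  exact ⟨e, fun _ => rfl, e.contDiff_symm hd (contDiff_syncLift a)⟩

/-! ### The synchronisation map is a diffeomorphism -/

theorem syncLift_add_periods (a : ℝ) (z : ℝ × ℝ) (m n : ℤ) :
    syncLift a (z + (m * (2 * π), n * (2 * π))) =
      syncLift a z + (m * (2 * π), n * (2 * π)) := by
  have h1 : Real.sin (z.1 + m * (2 * π) - (z.2 + n * (2 * π))) = Real.sin (z.1 - z.2) := by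
    rw [← Real.sin_add_int_mul_two_pi (z.1 - z.2) (m - n)]
    push_cast
    ring_nf
  have h2 : Real.sin (z.2 + n * (2 * π) - (z.1 + m * (2 * π))) = Real.sin (z.2 - z.1) := by
    rw [← Real.sin_add_int_mul_two_pi (z.2 - z.1) (n - m)]
    push_cast
    ring_nf
  simp only [syncLift, Prod.fst_add, Prod.snd_add, Real.sin_add_int_mul_two_pi, h1, h2]
  ext <;> simp only [Prod.fst_add, Prod.snd_add] <;> ring

theorem exists_diffeomorph_syncMap {a : ℝ} (ha : 0 < a) (ha' : a < 1 / 3) :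
    ∃ (e : (ℝ × ℝ) ≃ₜ (ℝ × ℝ)) (G : Torus ≃ₘ^1⟮torusModel, torusModel⟯ Torus),
      (∀ z, e z = syncLift a z) ∧ ContDiff ℝ 1 e.symm ∧ (∀ z, G z = syncMap a z) ∧
      Semiconj torusProj e.symm G.symm := by
  obtain ⟨e, he, hesm⟩ := exists_homeomorph_syncLift ha ha'
  have hper : ∀ (z : ℝ × ℝ) (m n : ℤ), e.symm (z + (m * (2 * π), n * (2 * π))) =
      e.symm z + (m * (2 * π), n * (2 * π)) := fun z m n => by
    rw [Homeomorph.symm_apply_eq, he, syncLift_add_periods, ← he, e.apply_symm_apply]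
  -- The choice of preimage is immaterial, as `e.symm` commutes with the periods.
  set g : Torus → Torus := fun w => torusProj (e.symm (surjInv surjective_torusProj w)) with hg
  have hsemi : Semiconj torusProj e.symm g := fun z => by
    obtain ⟨m, n, hmn⟩ := torusProj_eq_iff.1 (surjInv_eq surjective_torusProj (torusProj z))
    simp only [hg]
    rw [hmn, hper]
    exact torusProj_eq_iff.2 ⟨-m, -n, by ext <;> simp⟩
  have hs := semiconj_syncLift a
  let G : Torus ≃ₘ^1⟮torusModel, torusModel⟯ Torus :=
    { toFun := syncMap a
      invFun := g
      left_inv := fun w => by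
        obtain ⟨z, rfl⟩ := surjective_torusProj w
        rw [← hs.eq, ← hsemi.eq, ← he, e.symm_apply_apply]
      right_inv := fun w => by
        obtain ⟨z, rfl⟩ := surjective_torusProj w
        rw [← hsemi.eq, ← hs.eq, ← he, e.apply_symm_apply]
      contMDiff_toFun := contMDiff_of_semiconj hs (contDiff_syncLift a)
      contMDiff_invFun := contMDiff_of_semiconj hsemi hesm }
  exact ⟨e, G, he, hesm, fun _ => rfl, hsemi⟩

/-! ### The potential of the synchronisation map -/

/-- The derivative in `h` of right side minus left side is `h - (sin x - sin (x + h))`, nonnegative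
for `h ≥ 0` because sine is 1-Lipschitz; negative `h` follows by reflection. -/
theorem Real.cos_add_le (x h : ℝ) :
    Real.cos (x + h) ≤ Real.cos x - h * Real.sin x + h ^ 2 / 2 := by
  have main : ∀ x h : ℝ, 0 ≤ h →
      Real.cos (x + h) ≤ Real.cos x - h * Real.sin x + h ^ 2 / 2 := by
    intro x h hh
    have hd : ∀ t : ℝ, HasDerivAt
        (fun t : ℝ => Real.cos x - t * Real.sin x + t ^ 2 / 2 - Real.cos (x + t))
        (t - (Real.sin x - Real.sin (x + t))) t := fun t => by
      have h1 := ((((hasDerivAt_id t).mul_const (Real.sin x)).const_sub (Real.cos x)).add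
        ((hasDerivAt_pow 2 t).div_const 2)).sub ((hasDerivAt_id t).const_add x).cos
      refine h1.congr_deriv ?_
      simp
      ring
    have hmono : MonotoneOn
        (fun t : ℝ => Real.cos x - t * Real.sin x + t ^ 2 / 2 - Real.cos (x + t)) (Ici 0) := by
      refine monotoneOn_of_deriv_nonneg (convex_Ici 0)
        (fun t _ => (hd t).continuousAt.continuousWithinAt)
        (fun t _ => (hd t).differentiableAt.differentiableWithinAt) fun t ht => ?_
      rw [interior_Ici] at ht
      rw [(hd t).deriv]
      have h2 := sin_sub_sin_sq_le x (x + t)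
      have h3 : Real.sin x - Real.sin (x + t) ≤ t := by
        refine abs_le_of_sq_le_sq' ?_ (le_of_lt ht) |>.2
        linarith
      linarith
    have := hmono (mem_Ici.2 le_rfl) (mem_Ici.2 hh) hh
    simp only [zero_mul, sub_zero, add_zero, ne_eq, OfNat.ofNat_ne_zero, not_false_eq_true,
      zero_pow, zero_div, sub_self] at this
    linarith
  rcases le_total 0 h with hh | hh
  · exact main x h hh
  · have := main (-x) (-h) (by linarith)
    rw [← neg_add, Real.cos_neg, Real.cos_neg, Real.sin_neg] at this
    linarith

/-- The cosine function on `ℝ / 2πℤ`. -/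
noncomputable def circleCos : AddCircle (2 * π) → ℝ := Real.cos_periodic.lift

theorem circleCos_coe (t : ℝ) : circleCos (t : AddCircle (2 * π)) = Real.cos t :=
  Function.Periodic.lift_coe _ t

theorem continuous_circleCos : Continuous circleCos :=
  Real.Angle.continuous_cos

/-- The potential whose gradient flow `syncMap` discretises. -/
noncomputable def syncPotential (w : Torus) : ℝ :=
  circleCos w.1 + circleCos w.2 + circleCos (w.1 - w.2)

theorem syncPotential_torusPt (x y : ℝ) :
    syncPotential (torusPt x y) = Real.cos x + Real.cos y + Real.cos (x - y) := by
  simp only [syncPotential, torusPt, ← AddCircle.coe_sub, circleCos_coe]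

theorem continuous_syncPotential : Continuous syncPotential :=
  ((continuous_circleCos.comp continuous_fst).add (continuous_circleCos.comp continuous_snd)).add
    (continuous_circleCos.comp (continuous_fst.sub continuous_snd))

/-- Descent lemma: with `p, q` the two sums of sines, the first-order term is `-2a(p² + pq + q²)`
and the second-order bound is `3a²(p² + pq + q²)`, which is at most `a(p² + pq + q²)`. -/
theorem syncPotential_syncMap_le {a : ℝ} (ha : 0 < a) (ha' : a < 1 / 3) (x y : ℝ) :
    syncPotential (syncMap a (torusPt x y)) ≤ syncPotential (torusPt x y) -
      a * ((Real.sin x + Real.sin (x - y)) ^ 2 +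
        (Real.sin x + Real.sin (x - y)) * (Real.sin y - Real.sin (x - y)) +
        (Real.sin y - Real.sin (x - y)) ^ 2) := by
  have hs : Real.sin (y - x) = -Real.sin (x - y) := by rw [← Real.sin_neg, neg_sub]
  set h₁ := a * (2 * Real.sin x + Real.sin y + Real.sin (x - y)) with hh1
  set h₂ := a * (Real.sin x + 2 * Real.sin y - Real.sin (x - y)) with hh2
  have e1 : x + 2 * a * Real.sin x + a * Real.sin y + a * Real.sin (x - y) = x + h₁ := by
    rw [hh1]; ring
  have e2 : y + a * Real.sin x + 2 * a * Real.sin y + a * Real.sin (y - x) = y + h₂ := by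
    rw [hh2, hs]; ring
  rw [syncMap_torusPt, e1, e2, syncPotential_torusPt, syncPotential_torusPt]
  have b1 := Real.cos_add_le x h₁
  have b2 := Real.cos_add_le y h₂
  have b3 := Real.cos_add_le (x - y) (h₁ - h₂)
  rw [show x + h₁ - (y + h₂) = x - y + (h₁ - h₂) by ring]
  refine (add_le_add (add_le_add b1 b2) b3).trans ?_
  rw [hh1, hh2]
  generalize Real.sin x = s
  generalize Real.sin y = t
  generalize Real.sin (x - y) = u
  have hQ : 0 ≤ (s + u) ^ 2 + (s + u) * (t - u) + (t - u) ^ 2 := by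
    nlinarith [sq_nonneg (s + t), sq_nonneg (s + u), sq_nonneg (t - u)]
  have := mul_nonneg (mul_nonneg ha.le (by linarith : 0 ≤ 1 - 3 * a)) hQ
  linarith

theorem critical_of_le {a : ℝ} (ha : 0 < a) (ha' : a < 1 / 3) {x y : ℝ}
    (h : syncPotential (torusPt x y) ≤ syncPotential (syncMap a (torusPt x y))) :
    Real.sin x + Real.sin (x - y) = 0 ∧ Real.sin y - Real.sin (x - y) = 0 := by
  have h1 := syncPotential_syncMap_le ha ha' x y
  generalize Real.sin x + Real.sin (x - y) = p at *
  generalize Real.sin y - Real.sin (x - y) = q at *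
  have h2 : p ^ 2 + p * q + q ^ 2 ≤ 0 := by
    by_contra! hc
    have := mul_pos ha hc
    linarith
  exact ⟨(pow_eq_zero_iff two_ne_zero).1
      (le_antisymm (by linarith [sq_nonneg (p + q), sq_nonneg q]) (sq_nonneg _)),
    (pow_eq_zero_iff two_ne_zero).1
      (le_antisymm (by linarith [sq_nonneg (p + q), sq_nonneg p]) (sq_nonneg _))⟩

theorem syncLift_eq_self (a : ℝ) {z : ℝ × ℝ} (h1 : Real.sin z.1 + Real.sin (z.1 - z.2) = 0)
    (h2 : Real.sin z.2 - Real.sin (z.1 - z.2) = 0) : syncLift a z = z := by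
  have hs : Real.sin (z.2 - z.1) = -Real.sin (z.1 - z.2) := by rw [← Real.sin_neg, neg_sub]
  ext
  · simp only [syncLift]
    linear_combination 2 * a * h1 + a * h2
  · simp only [syncLift, hs]
    linear_combination a * h1 + 2 * a * h2

theorem isStrictLyapunov_syncMap {a : ℝ} (ha : 0 < a) (ha' : a < 1 / 3) :
    IsStrictLyapunov (syncMap a) syncPotential where
  continuous_map :=
    (contMDiff_of_semiconj (semiconj_syncLift a) (contDiff_syncLift a)).continuous
  continuous := continuous_syncPotential
  lt_of_not_isFixedPt w hw := by
    by_contra! h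
    obtain ⟨z, rfl⟩ := surjective_torusProj w
    have hz := critical_of_le ha ha' (x := z.1) (y := z.2) h
    exact hw (((semiconj_syncLift a).eq z).symm.trans
      (congrArg torusProj (syncLift_eq_self a hz.1 hz.2)))

theorem IsStrictLyapunov.symm {M : Type*} [TopologicalSpace M] {f g : M → M} {V : M → ℝ}
    (h : IsStrictLyapunov f V) (hg : Continuous g) (hfg : RightInverse g f) :
    IsStrictLyapunov g fun x => -V x where
  continuous_map := hg
  continuous := h.continuous.neg
  lt_of_not_isFixedPt x hx := by
    have h1 := h.lt_of_not_isFixedPt (g x) fun hfix => hx (by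
      have h2 : f (g x) = g x := hfix
      rw [hfg x] at h2
      exact h2.symm)
    rw [hfg x] at h1
    exact neg_lt_neg h1

/-! ### The fixed points -/

/-- Equal sines mean equal angles or angles of sum `π`. If `X = -Y`, the second equation gives `3X =
0` or `X = π`; if `X - Y = π`, it gives `sin Y = 0`. -/
theorem Real.Angle.eq_of_sin_eq {X Y : Real.Angle} (h1 : X.sin = (-Y).sin)
    (h2 : Y.sin = (X - Y).sin) :
    X = 0 ∧ Y = 0 ∨ X = 0 ∧ Y = (π : ℝ) ∨ X = (π : ℝ) ∧ Y = 0 ∨ X = (π : ℝ) ∧ Y = (π : ℝ) ∨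
      X = (2 * π / 3 : ℝ) ∧ Y = (4 * π / 3 : ℝ) ∨ X = (4 * π / 3 : ℝ) ∧ Y = (2 * π / 3 : ℝ) := by
  have hπ : (π : Real.Angle) + π = 0 := by
    rw [← Real.Angle.coe_add, ← two_mul, Real.Angle.coe_two_pi]
  have h24 : -((2 * π / 3 : ℝ) : Real.Angle) = (4 * π / 3 : ℝ) := by
    rw [neg_eq_iff_add_eq_zero, ← Real.Angle.coe_add, ← Real.Angle.coe_two_pi]
    ring_nf
  have hsin : ∀ U W : Real.Angle, U.sin = W.sin → U = W ∨ U + W = π := fun U W h => by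
    induction U using Real.Angle.induction_on
    induction W using Real.Angle.induction_on
    exact Real.Angle.sin_eq_iff_coe_eq_or_add_eq_pi.1 h
  rcases hsin _ _ h1 with h | h
  · obtain rfl : Y = -X := by rw [h, neg_neg]
    rcases hsin _ _ h2 with h | h
    · have h3 : 3 • X = 3 • (0 : Real.Angle) := by
        rw [nsmul_zero, ← sub_eq_zero.2 h.symm]
        abel
      obtain ⟨k, hk⟩ := (Real.Angle.nsmul_eq_iff three_ne_zero).1 h3
      rw [zero_add] at hk
      fin_cases k
      · have hX : X = 0 := by simpa using hk
        exact Or.inl ⟨hX, by rw [hX, neg_zero]⟩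
      · have hX : X = (2 * π / 3 : ℝ) := by simpa using hk
        exact Or.inr (Or.inr (Or.inr (Or.inr (Or.inl ⟨hX, by rw [hX, h24]⟩))))
      · have hX : X = (4 * π / 3 : ℝ) := by
          rw [hk, ← Real.Angle.coe_nsmul]
          congr 1
          simp
          ring
        exact Or.inr (Or.inr (Or.inr (Or.inr (Or.inr ⟨hX, by rw [hX, ← h24, neg_neg]⟩))))
    · have hX : X = π := by
        rw [← h]
        abel
      exact Or.inr (Or.inr (Or.inr (Or.inl ⟨hX, by rw [hX, Real.Angle.neg_coe_pi]⟩)))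
  · obtain rfl : X = π + Y := by rw [← h, neg_add_cancel_right]
    rw [add_sub_cancel_right, Real.Angle.sin_coe_pi, Real.Angle.sin_eq_zero_iff] at h2
    rcases h2 with rfl | rfl
    · exact Or.inr (Or.inr (Or.inl ⟨add_zero _, rfl⟩))
    · exact Or.inr (Or.inl ⟨hπ, rfl⟩)

/-- The fixed points of the synchronisation map and its lift. -/
def syncFixedPoints : Set (ℝ × ℝ) :=
  {(0, 0), (0, π), (π, 0), (π, π), (2 * π / 3, 4 * π / 3), (4 * π / 3, 2 * π / 3)}

theorem sin_two_pi_div_three : Real.sin (2 * π / 3) = √3 / 2 := by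
  rw [show 2 * π / 3 = π - π / 3 by ring, Real.sin_pi_sub, Real.sin_pi_div_three]

theorem sin_four_pi_div_three : Real.sin (4 * π / 3) = -(√3 / 2) := by
  rw [show 4 * π / 3 = π / 3 + π by ring, Real.sin_add_pi, Real.sin_pi_div_three]

theorem cos_two_pi_div_three : Real.cos (2 * π / 3) = -(1 / 2) := by
  rw [show 2 * π / 3 = π - π / 3 by ring, Real.cos_pi_sub, Real.cos_pi_div_three]

theorem cos_four_pi_div_three : Real.cos (4 * π / 3) = -(1 / 2) := by
  rw [show 4 * π / 3 = π / 3 + π by ring, Real.cos_add_pi, Real.cos_pi_div_three]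

theorem syncLift_eq_self_of_mem (a : ℝ) {z : ℝ × ℝ} (hz : z ∈ syncFixedPoints) :
    syncLift a z = z := by
  refine syncLift_eq_self a ?_ ?_ <;> rcases hz with rfl | rfl | rfl | rfl | rfl | rfl <;>
    simp [sin_two_pi_div_three, sin_four_pi_div_three,
      show 2 * π / 3 - 4 * π / 3 = -(2 * π / 3) by ring,
      show 4 * π / 3 - 2 * π / 3 = 2 * π / 3 by ring]

theorem isFixedPt_syncMap_of_mem (a : ℝ) {z : ℝ × ℝ} (hz : z ∈ syncFixedPoints) :
    IsFixedPt (syncMap a) (torusProj z) :=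
  ((semiconj_syncLift a).eq z).symm.trans (congrArg torusProj (syncLift_eq_self_of_mem a hz))

theorem fixedPoints_syncMap {a : ℝ} (ha : 0 < a) (ha' : a < 1 / 3) :
    fixedPoints (syncMap a) = torusProj '' syncFixedPoints := by
  refine Subset.antisymm (fun w hw => ?_) ?_
  · obtain ⟨z, rfl⟩ := surjective_torusProj w
    have hcrit := critical_of_le ha ha' (x := z.1) (y := z.2) (congrArg syncPotential hw).ge
    have h := Real.Angle.eq_of_sin_eq (X := (z.1 : Real.Angle)) (Y := (z.2 : Real.Angle))
      (by rw [← Real.Angle.coe_neg, Real.Angle.sin_coe, Real.Angle.sin_coe, Real.sin_neg]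
          linarith)
      (by rw [← Real.Angle.coe_sub, Real.Angle.sin_coe, Real.Angle.sin_coe]
          linarith)
    have key : ∀ x y : ℝ, (z.1 : Real.Angle) = x ∧ (z.2 : Real.Angle) = y →
        torusProj (x, y) = torusProj z := fun x y hxy => Prod.ext hxy.1.symm hxy.2.symm
    rcases h with h | h | h | h | h | h
    · exact ⟨(0, 0), by simp [syncFixedPoints], key 0 0 h⟩
    · exact ⟨(0, π), by simp [syncFixedPoints], key 0 π h⟩
    · exact ⟨(π, 0), by simp [syncFixedPoints], key π 0 h⟩
    · exact ⟨(π, π), by simp [syncFixedPoints], key π π h⟩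
    · exact ⟨(2 * π / 3, 4 * π / 3), by simp [syncFixedPoints], key _ _ h⟩
    · exact ⟨(4 * π / 3, 2 * π / 3), by simp [syncFixedPoints], key _ _ h⟩
  · rintro _ ⟨z, hz, rfl⟩
    exact isFixedPt_syncMap_of_mem a hz

theorem injOn_torusProj_syncFixedPoints : InjOn torusProj syncFixedPoints := by
  have hsub : ∀ z ∈ syncFixedPoints, z.1 ∈ Ico 0 (0 + 2 * π) ∧ z.2 ∈ Ico 0 (0 + 2 * π) := by
    have := Real.pi_pos
    rintro z (rfl | rfl | rfl | rfl | rfl | rfl) <;>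
      exact ⟨⟨by positivity, by linarith⟩, ⟨by positivity, by linarith⟩⟩
  intro z hz w hw h
  have h' := Prod.ext_iff.1 h
  exact Prod.ext ((AddCircle.coe_eq_coe_iff_of_mem_Ico (hsub z hz).1 (hsub w hw).1).1 h'.1)
    ((AddCircle.coe_eq_coe_iff_of_mem_Ico (hsub z hz).2 (hsub w hw).2).1 h'.2)

theorem ncard_syncFixedPoints : syncFixedPoints.ncard = 6 := by
  have hπ := Real.pi_ne_zero
  have h1 : ∀ c : ℝ, c ≠ 1 → c * π ≠ π := fun c hc h => hc (mul_right_cancel₀ hπ (by linarith))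
  have h2 : (2 / 3 : ℝ) * π ≠ 4 / 3 * π := fun h => by
    have := mul_right_cancel₀ hπ h
    norm_num at this
  have e1 : 2 * π / 3 = 2 / 3 * π := by ring
  have e2 : 4 * π / 3 = 4 / 3 * π := by ring
  have h3 := h1 (2 / 3) (by norm_num)
  have h4 := h1 (4 / 3) (by norm_num)
  rw [syncFixedPoints, e1, e2]
  rw [ncard_insert_of_notMem, ncard_insert_of_notMem, ncard_insert_of_notMem,
    ncard_insert_of_notMem, ncard_insert_of_notMem, ncard_singleton]
  all_goals simp [hπ, hπ.symm, h2, h3.symm, h4.symm]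

/-! ### Multipliers of the fixed points -/

theorem multipliers_syncMap {a : ℝ} {z : ℝ × ℝ} (hz : z ∈ syncFixedPoints) {l m : ℝ}
    (htr : l + m = 2 + 2 * a * (Real.cos z.1 + Real.cos z.2 + Real.cos (z.1 - z.2)))
    (hdet : l * m = (1 + a * (2 * Real.cos z.1 + Real.cos (z.1 - z.2))) *
        (1 + a * (2 * Real.cos z.2 + Real.cos (z.1 - z.2))) -
      a * (Real.cos z.2 - Real.cos (z.1 - z.2)) * (a * (Real.cos z.1 - Real.cos (z.1 - z.2)))) :
    multipliers torusModel (syncMap a) (torusProj z) = {(l : ℂ), (m : ℂ)} := by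
  have hD := returnDeriv_of_semiconj (semiconj_syncLift a) (contDiff_syncLift a)
    (syncLift_eq_self_of_mem a hz) (hasFDerivAt_syncLift a z)
  generalize Real.cos z.1 = α at *
  generalize Real.cos z.2 = β at *
  generalize Real.cos (z.1 - z.2) = γ at *
  have hM : LinearMap.toMatrix (Module.Basis.finTwoProd ℝ) (Module.Basis.finTwoProd ℝ)
      (couplingMap a α β γ : ℝ × ℝ →ₗ[ℝ] ℝ × ℝ) =
      !![1 + a * (2 * α + γ), a * (β - γ); a * (α - γ), 1 + a * (2 * β + γ)] := by
    ext i j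
    fin_cases i <;> fin_cases j <;> simp [LinearMap.toMatrix_apply, couplingMap_apply]
  ext ζ
  have hchar : (couplingMap a α β γ : ℝ × ℝ →ₗ[ℝ] ℝ × ℝ).charpoly =
      Polynomial.X ^ 2 - Polynomial.C (l + m) * Polynomial.X + Polynomial.C (l * m) := by
    rw [← LinearMap.charpoly_toMatrix _ (Module.Basis.finTwoProd ℝ), hM, Matrix.charpoly_fin_two,
      Matrix.trace_fin_two_of, Matrix.det_fin_two_of, htr, hdet]
    congr 4
    ring
  have hev : Polynomial.aeval ζ (couplingMap a α β γ : ℝ × ℝ →ₗ[ℝ] ℝ × ℝ).charpoly =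
      (ζ - l) * (ζ - m) := by
    rw [hchar]
    simp
    ring
  rw [multipliers, hD]
  simp only [mem_ofPred_eq, hev, mul_eq_zero, sub_eq_zero, mem_insert_iff, mem_singleton_iff]

theorem isHyperbolicPeriodicPt_syncMap {a : ℝ} {z : ℝ × ℝ} (hz : z ∈ syncFixedPoints) {l m : ℝ}
    (hm : multipliers torusModel (syncMap a) (torusProj z) = {(l : ℂ), (m : ℂ)})
    (h1 : |l| ≠ 1) (h2 : |m| ≠ 1) :
    IsHyperbolicPeriodicPt torusModel (syncMap a) (torusProj z) := by
  refine ⟨⟨1, one_pos, isFixedPt_syncMap_of_mem a hz⟩, ?_⟩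
  rw [hm]
  rintro _ (rfl | rfl)
  · rwa [Complex.norm_real]
  · rwa [Complex.norm_real]

section Types

variable {a : ℝ} (ha : 0 < a) (ha' : a < 1 / 3)
include ha

theorem isSource_syncMap : IsSource torusModel (syncMap a) (torusProj (0, 0)) := by
  have hz : ((0, 0) : ℝ × ℝ) ∈ syncFixedPoints := by simp [syncFixedPoints]
  have hm := multipliers_syncMap (a := a) hz (l := 1 + 3 * a) (m := 1 + 3 * a)
    (by norm_num; ring) (by norm_num; ring)
  have hl : 1 < |1 + 3 * a| := lt_abs.2 (Or.inl (by linarith))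
  refine ⟨isFixedPt_syncMap_of_mem a hz, isHyperbolicPeriodicPt_syncMap hz hm hl.ne' hl.ne', ?_⟩
  intro ζ hζ
  obtain rfl : ζ = ((1 + 3 * a : ℝ) : ℂ) := by simpa using hm.subset hζ
  rwa [Complex.norm_real]

include ha'

theorem isSaddle_of_multipliers {z : ℝ × ℝ} (hz : z ∈ syncFixedPoints)
    (hm : multipliers torusModel (syncMap a) (torusProj z) =
      {((1 - 3 * a : ℝ) : ℂ), ((1 + a : ℝ) : ℂ)}) :
    IsSaddle torusModel (syncMap a) (torusProj z) := by
  have hl : |1 - 3 * a| < 1 := abs_lt.2 ⟨by linarith, by linarith⟩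
  have hu : 1 < |1 + a| := lt_abs.2 (Or.inl (by linarith))
  refine ⟨isFixedPt_syncMap_of_mem a hz, isHyperbolicPeriodicPt_syncMap hz hm hl.ne hu.ne', ?_⟩
  rw [hm]
  refine ⟨⟨_, Or.inl rfl, ?_⟩, ⟨_, Or.inr rfl, ?_⟩⟩ <;> rwa [Complex.norm_real]

theorem isSink_of_multipliers {z : ℝ × ℝ} (hz : z ∈ syncFixedPoints)
    (hm : multipliers torusModel (syncMap a) (torusProj z) =
      {((1 - 3 / 2 * a : ℝ) : ℂ), ((1 - 3 / 2 * a : ℝ) : ℂ)}) :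
    IsSink torusModel (syncMap a) (torusProj z) := by
  have hl : |1 - 3 / 2 * a| < 1 := abs_lt.2 ⟨by linarith, by linarith⟩
  refine ⟨isFixedPt_syncMap_of_mem a hz, isHyperbolicPeriodicPt_syncMap hz hm hl.ne hl.ne, ?_⟩
  rw [hm]
  rintro _ (rfl | rfl) <;> rwa [Complex.norm_real]

theorem isSaddle_syncMap_zero_pi : IsSaddle torusModel (syncMap a) (torusProj (0, π)) :=
  have hz : (0, π) ∈ syncFixedPoints := by simp [syncFixedPoints]
  isSaddle_of_multipliers ha ha' hz
    (multipliers_syncMap hz (by norm_num; ring) (by norm_num; ring))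

theorem isSaddle_syncMap_pi_zero : IsSaddle torusModel (syncMap a) (torusProj (π, 0)) :=
  have hz : (π, 0) ∈ syncFixedPoints := by simp [syncFixedPoints]
  isSaddle_of_multipliers ha ha' hz
    (multipliers_syncMap hz (by norm_num; ring)
      (by simp only [Real.cos_zero, Real.cos_pi, sub_zero]; ring))

theorem isSaddle_syncMap_pi_pi : IsSaddle torusModel (syncMap a) (torusProj (π, π)) :=
  have hz : (π, π) ∈ syncFixedPoints := by simp [syncFixedPoints]
  isSaddle_of_multipliers ha ha' hz
    (multipliers_syncMap hz (by norm_num; ring) (by norm_num; ring))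

theorem isSink_syncMap_left :
    IsSink torusModel (syncMap a) (torusProj (2 * π / 3, 4 * π / 3)) := by
  have hz : (2 * π / 3, 4 * π / 3) ∈ syncFixedPoints := by simp [syncFixedPoints]
  refine isSink_of_multipliers ha ha' hz (multipliers_syncMap hz ?_ ?_) <;>
    simp only [cos_two_pi_div_three, cos_four_pi_div_three, Real.cos_neg,
      show 2 * π / 3 - 4 * π / 3 = -(2 * π / 3) by ring] <;> ring

theorem isSink_syncMap_right :
    IsSink torusModel (syncMap a) (torusProj (4 * π / 3, 2 * π / 3)) := by
  have hz : (4 * π / 3, 2 * π / 3) ∈ syncFixedPoints := by simp [syncFixedPoints]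
  refine isSink_of_multipliers ha ha' hz (multipliers_syncMap hz ?_ ?_) <;>
    simp only [cos_two_pi_div_three, cos_four_pi_div_three,
      show 4 * π / 3 - 2 * π / 3 = 2 * π / 3 by ring] <;> ring

end Types

/-! ### Transversality -/

theorem couplingMap_self (a c : ℝ) :
    couplingMap a c c c = (1 + 3 * a * c) • ContinuousLinearMap.id ℝ (ℝ × ℝ) := by
  refine ContinuousLinearMap.ext fun v => ?_
  rw [couplingMap_apply]
  ext <;> simp only [smul_apply, ContinuousLinearMap.id_apply, Prod.smul_fst, Prod.smul_snd,
    smul_eq_mul] <;> ring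

/-- At a fixed point where the three cosines agree with a negative number, the map is
contracting. -/
theorem attractedNear_syncMap {a : ℝ} (ha : 0 < a) (ha' : a < 1 / 3) {z : ℝ × ℝ}
    (hz : z ∈ syncFixedPoints) (h1 : Real.cos z.1 = -(1 / 2)) (h2 : Real.cos z.2 = -(1 / 2))
    (h3 : Real.cos (z.1 - z.2) = -(1 / 2)) :
    AttractedNear (syncMap a) (torusProj z) (torusProj z) := by
  refine AttractedNear.of_semiconj continuous_torusProj isOpenMap_torusProj (semiconj_syncLift a)
    (attractedNear_of_hasFDerivAt (c := 1 + 3 * a * -(1 / 2)) ?_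
      (syncLift_eq_self_of_mem a hz) ?_)
  · exact abs_lt.2 ⟨by linarith, by linarith⟩
  · rw [← couplingMap_self]
    have := hasFDerivAt_syncLift a z
    rwa [h1, h2, h3] at this

theorem attractedNear_symm_zero {a : ℝ} (ha : 0 < a) {e : (ℝ × ℝ) ≃ₜ (ℝ × ℝ)} {g : Torus → Torus}
    (he : ∀ z, e z = syncLift a z) (hes : ContDiff ℝ 1 e.symm)
    (hg : Semiconj torusProj e.symm g) : AttractedNear g (torusPt 0 0) (torusPt 0 0) := by
  have h0 : e.symm (0, 0) = (0, 0) := by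
    rw [Homeomorph.symm_apply_eq, he, syncLift_eq_self_of_mem a (by simp [syncFixedPoints])]
  have hpos : 0 < 1 + 3 * a := by linarith
  refine AttractedNear.of_semiconj (p := (0, 0)) continuous_torusProj isOpenMap_torusProj hg
    (attractedNear_of_hasFDerivAt (c := (1 + 3 * a)⁻¹) ?_ h0 ?_)
  · rw [abs_of_pos (inv_pos.2 hpos)]
    exact inv_lt_one_of_one_lt₀ (by linarith)
  · have hd := (hes.differentiable one_ne_zero (0, 0)).hasFDerivAt
    have h1 : HasFDerivAt (syncLift a) ((1 + 3 * a * 1) • ContinuousLinearMap.id ℝ (ℝ × ℝ))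
        (e.symm (0, 0)) := by
      rw [h0, ← couplingMap_self]
      simpa using hasFDerivAt_syncLift a (0, 0)
    have h2 := h1.comp (0, 0) hd
    have h3 : syncLift a ∘ e.symm = id := funext fun z => by
      rw [comp_apply, ← he, e.apply_symm_apply, id]
    rw [h3] at h2
    have h4 := h2.unique (hasFDerivAt_id _)
    refine hd.congr_fderiv (ContinuousLinearMap.ext fun v => ?_)
    have h5 := congrArg (fun A : ℝ × ℝ →L[ℝ] ℝ × ℝ => (1 + 3 * a)⁻¹ • A v) h4
    simpa [smul_smul, inv_mul_cancel₀ hpos.ne'] using h5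

/-- The map inverted here is the dynamics on the unstable line of a saddle; its derivative is at
least `1 - 3a > 0`. The inverse `k` is the action of the inverse diffeomorphism on that line. -/
theorem exists_rightInverse_unstable {a : ℝ} (ha : 0 < a) (ha' : a < 1 / 3) :
    ∃ k : ℝ → ℝ, (∀ s, k s + a * (Real.sin (2 * k s) - Real.sin (k s)) = s) ∧ k 0 = 0 ∧
      HasDerivAt k (1 + a)⁻¹ 0 := by
  set h : ℝ → ℝ := fun t => t + a * (Real.sin (2 * t) - Real.sin t) with hh
  have hd : ∀ t, HasDerivAt h (1 + a * (Real.cos (2 * t) * 2 - Real.cos t)) t := fun t => by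
    have h1 : HasDerivAt (fun t : ℝ => Real.sin (2 * t)) (Real.cos (2 * t) * 2) t := by
      simpa using ((hasDerivAt_id t).const_mul 2).sin
    exact (hasDerivAt_id t).add ((h1.sub (Real.hasDerivAt_sin t)).const_mul a)
  have hmono : StrictMono h := strictMono_of_deriv_pos fun t => by
    rw [(hd t).deriv]
    have h1 := Real.neg_one_le_cos (2 * t)
    have h2 := Real.cos_le_one t
    nlinarith
  have hcont : Continuous h := by fun_prop
  have hb : ∀ t, |a * (Real.sin (2 * t) - Real.sin t)| ≤ 1 := fun t => by
    have h1 := Real.abs_sin_le_one (2 * t)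
    have h2 := Real.abs_sin_le_one t
    have h3 := abs_sub (Real.sin (2 * t)) (Real.sin t)
    rw [abs_mul, abs_of_pos ha]
    nlinarith [abs_nonneg (Real.sin (2 * t) - Real.sin t)]
  have hsurj : Surjective h := hcont.surjective
    (tendsto_atTop_mono (fun t => show t + -1 ≤ h t by linarith [(abs_le.1 (hb t)).1])
      (tendsto_atTop_add_const_right _ (-1) tendsto_id))
    (tendsto_atBot_mono (fun t => show h t ≤ t + 1 by linarith [(abs_le.1 (hb t)).2])
      (tendsto_atBot_add_const_right _ 1 tendsto_id))
  set o := hmono.orderIsoOfSurjective h hsurj with ho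
  have h0 : h 0 = 0 := by simp [hh]
  have hk : ∀ s, h (o.symm s) = s := fun s => o.apply_symm_apply s
  have hk0 : o.symm 0 = 0 := hmono.injective ((hk 0).trans h0.symm)
  refine ⟨o.symm, hk, hk0, ?_⟩
  refine HasDerivAt.of_local_left_inverse o.symm.continuous.continuousAt (f := h) ?_
    (by linarith) (Eventually.of_forall hk)
  rw [hk0]
  refine (hd 0).congr_deriv ?_
  norm_num

/-- Cramer's rule in the basis `u, w`. -/
theorem sup_eq_top_of_mem {S T : Submodule ℝ (ℝ × ℝ)} {u w : ℝ × ℝ} (hu : u ∈ S) (hw : w ∈ T)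
    (h : u.1 * w.2 - u.2 * w.1 ≠ 0) : S ⊔ T = ⊤ := by
  refine eq_top_iff.2 fun v _ => ?_
  have hv : v = ((v.1 * w.2 - v.2 * w.1) / (u.1 * w.2 - u.2 * w.1)) • u +
      ((u.1 * v.2 - u.2 * v.1) / (u.1 * w.2 - u.2 * w.1)) • w := by
    ext <;> simp only [Prod.fst_add, Prod.snd_add, Prod.smul_fst, Prod.smul_snd, smul_eq_mul] <;>
      rw [div_mul_eq_mul_div, div_mul_eq_mul_div, ← add_div, eq_div_iff h] <;> ring
  rw [hv]
  exact Submodule.add_mem_sup (S.smul_mem _ hu) (T.smul_mem _ hw)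

/-- Transversality at a saddle through which two invariant lines pass. -/
theorem transverse_of_lines {a : ℝ} (ha : 0 < a) (ha' : a < 1 / 3) {e : (ℝ × ℝ) ≃ₜ (ℝ × ℝ)}
    {g : Torus → Torus} (he : ∀ z, e z = syncLift a z) (hg : Semiconj torusProj e.symm g)
    {z u w : ℝ × ℝ} (hu : ∀ t : ℝ, syncLift a (z + t • u) = z + (t - 3 * a * Real.sin t) • u)
    (hw : ∀ t : ℝ, syncLift a (z + t • w) = z + (t + a * (Real.sin (2 * t) - Real.sin t)) • w)
    (h : u.1 * w.2 - u.2 * w.1 ≠ 0) :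
    stableTangent torusModel (syncMap a) (torusProj z) (torusProj z) ⊔
      stableTangent torusModel g (torusProj z) (torusProj z) = ⊤ := by
  obtain ⟨k, hk, hk0, hkd⟩ := exists_rightInverse_unstable ha ha'
  refine sup_eq_top_of_mem (u := u) (w := w) ?_ ?_ h
  · refine mem_stableTangent_of_line (h := fun t => t - 3 * a * Real.sin t) (c := 1 - 3 * a)
      (fun t => ?_) (by simp) ?_ (abs_lt.2 ⟨by linarith, by linarith⟩)
    · rw [← (semiconj_syncLift a).eq, hu]
    · exact ((hasDerivAt_id (0 : ℝ)).sub ((Real.hasDerivAt_sin 0).const_mul (3 * a))).congr_deriv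
        (by simp)
  · refine mem_stableTangent_of_line (h := k) (fun s => ?_) hk0 hkd ?_
    · rw [← hg.eq]
      congr 1
      rw [Homeomorph.symm_apply_eq, he, hw, hk]
    · rw [abs_of_pos (by positivity)]
      exact inv_lt_one_of_one_lt₀ (by linarith)

/-- Regard `x, y, 0` as three phases; at each saddle two agree and the third is opposite. Along `u`
the two stay equal (multiplier `1 - 3a`); along `w` they are placed symmetrically about the antipode
of the third (multiplier `1 + a`). -/
theorem transverse_saddles {a : ℝ} (ha : 0 < a) (ha' : a < 1 / 3) {e : (ℝ × ℝ) ≃ₜ (ℝ × ℝ)}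
    {g : Torus → Torus} (he : ∀ z, e z = syncLift a z) (hg : Semiconj torusProj e.symm g)
    {z : ℝ × ℝ} (hz : z = (0, π) ∨ z = (π, 0) ∨ z = (π, π)) :
    stableTangent torusModel (syncMap a) (torusProj z) (torusProj z) ⊔
      stableTangent torusModel g (torusProj z) (torusProj z) = ⊤ := by
  have s1 : ∀ t : ℝ, Real.sin (π + t) = -Real.sin t := fun t => by rw [add_comm, Real.sin_add_pi]
  have s2 : ∀ t : ℝ, Real.sin (2 * t - (π + t)) = -Real.sin t := fun t => by
    rw [show 2 * t - (π + t) = t - π by ring, Real.sin_sub_pi]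
  have s3 : ∀ t : ℝ, Real.sin (π + t - 2 * t) = Real.sin t := fun t => by
    rw [show π + t - 2 * t = π - t by ring, Real.sin_pi_sub]
  have s4 : ∀ t : ℝ, Real.sin (π + t - (π + -t)) = Real.sin (2 * t) := fun t => by ring_nf
  have s5 : ∀ t : ℝ, Real.sin (π + -t - (π + t)) = -Real.sin (2 * t) := fun t => by
    rw [← Real.sin_neg]
    ring_nf
  rcases hz with rfl | rfl | rfl
  · refine transverse_of_lines ha ha' he hg (u := (0, 1)) (w := (2, 1)) (fun t => ?_) (fun t => ?_)
      (by norm_num) <;> ext <;>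
    simp only [syncLift, Prod.fst_add, Prod.snd_add, Prod.smul_fst, Prod.smul_snd, smul_eq_mul,
      mul_zero, mul_one, add_zero, zero_add, zero_sub, sub_zero, mul_neg, Real.sin_zero,
      mul_comm t 2, Real.sin_neg, s1, s2, s3] <;> ring
  · refine transverse_of_lines ha ha' he hg (u := (1, 0)) (w := (1, 2)) (fun t => ?_) (fun t => ?_)
      (by norm_num) <;> ext <;>
    simp only [syncLift, Prod.fst_add, Prod.snd_add, Prod.smul_fst, Prod.smul_snd, smul_eq_mul,
      mul_zero, mul_one, add_zero, zero_add, zero_sub, sub_zero, mul_neg, Real.sin_zero,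
      mul_comm t 2, Real.sin_neg, s1, s2, s3] <;> ring
  · refine transverse_of_lines ha ha' he hg (u := (1, 1)) (w := (1, -1)) (fun t => ?_)
      (fun t => ?_) (by norm_num) <;> ext <;>
    simp only [syncLift, Prod.fst_add, Prod.snd_add, Prod.smul_fst, Prod.smul_snd, smul_eq_mul,
      mul_zero, mul_one, add_zero, sub_self, mul_neg, Real.sin_zero,
      Real.sin_neg, s1, s4 t, s5 t] <;> ring

theorem transverse_syncMap {a : ℝ} (ha : 0 < a) (ha' : a < 1 / 3) {e : (ℝ × ℝ) ≃ₜ (ℝ × ℝ)}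
    {g : Torus → Torus} (he : ∀ z, e z = syncLift a z) (hes : ContDiff ℝ 1 e.symm)
    (hg : Semiconj torusProj e.symm g) (hgc : Continuous g) (hgi : RightInverse g (syncMap a))
    {z z' : ℝ × ℝ} (hz : z ∈ syncFixedPoints) (hz' : z' ∈ syncFixedPoints) {x : Torus}
    (hx : x ∈ stableSet (syncMap a) (torusProj z)) (hx' : x ∈ stableSet g (torusProj z')) :
    stableTangent torusModel (syncMap a) (torusProj z) x ⊔
      stableTangent torusModel g (torusProj z') x = ⊤ := by
  have hV := isStrictLyapunov_syncMap ha ha'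
  have hV' := hV.symm hgc hgi
  have hfix := isFixedPt_syncMap_of_mem a hz
  have hfix' : IsFixedPt g (torusProj z') := by
    refine (hg.eq z').symm.trans (congrArg torusProj ?_)
    rw [Homeomorph.symm_apply_eq, he, syncLift_eq_self_of_mem a hz']
  rw [stableSet, returnMap_of_isFixedPt hfix] at hx
  rw [stableSet, returnMap_of_isFixedPt hfix'] at hx'
  have hle := hV.limit_le hx
  have hle' := neg_le_neg_iff.1 (hV'.limit_le hx')
  have sink : ∀ w ∈ syncFixedPoints, Real.cos w.1 = -(1 / 2) → Real.cos w.2 = -(1 / 2) →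
      Real.cos (w.1 - w.2) = -(1 / 2) → z = w →
      stableTangent torusModel (syncMap a) (torusProj z) x ⊔
        stableTangent torusModel g (torusProj z') x = ⊤ := by
    rintro w hw h1 h2 h3 rfl
    rw [stableTangent_eq_top hfix ((attractedNear_syncMap ha ha' hz h1 h2 h3).of_tendsto
      hV.continuous_map hx), top_sup_eq]
  have e1 : (2 * π / 3 - 4 * π / 3) = -(2 * π / 3) := by ring
  have e2 : (4 * π / 3 - 2 * π / 3) = 2 * π / 3 := by ring
  have hcase : z = (0, 0) ∨ (z = (0, π) ∨ z = (π, 0) ∨ z = (π, π)) ∨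
      z = (2 * π / 3, 4 * π / 3) ∨ z = (4 * π / 3, 2 * π / 3) := by
    simpa only [syncFixedPoints, mem_insert_iff, mem_singleton_iff, or_assoc] using hz
  -- The potential satisfies `V(z) ≤ V(x) ≤ V(z')`. If the outer values agree, `V` cannot drop along
  -- the orbit, so `x` is fixed and equals both limits.
  have hsame : syncPotential (torusProj z') ≤ syncPotential (torusProj z) →
      x = torusProj z ∧ torusProj z = torusProj z' := fun hle0 => by
    have hxf := hV.isFixedPt_of_le_limit hx (hle'.trans hle0)
    have hxf' := hV'.isFixedPt_of_le_limit hx' (neg_le_neg (hle0.trans hle))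
    have t1 : Tendsto (fun n : ℕ => (syncMap a)^[n] x) atTop (𝓝 x) := by
      simp only [fun n => (hxf.iterate n).eq, tendsto_const_nhds]
    have t2 : Tendsto (fun n : ℕ => g^[n] x) atTop (𝓝 x) := by
      simp only [fun n => (hxf'.iterate n).eq, tendsto_const_nhds]
    have h1 := tendsto_nhds_unique t1 hx
    exact ⟨h1, h1.symm.trans (tendsto_nhds_unique t2 hx')⟩
  by_cases hsource : z' = (0, 0)
  · subst hsource
    rw [stableTangent_eq_top hfix' ((attractedNear_symm_zero ha he hes hg).of_tendsto hgc hx'),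
      sup_top_eq]
  -- Away from the source the potential is `-1` or `-3/2`. This excludes `z = (0, 0)`, where it is
  -- `3`, and puts a saddle `z` in the scope of `hsame`.
  have hlow : syncPotential (torusProj z') ≤ -1 := by
    rcases hz' with rfl | rfl | rfl | rfl | rfl | rfl
    · exact absurd rfl hsource
    all_goals
      rw [torusProj, syncPotential_torusPt]
      simp only [cos_two_pi_div_three, cos_four_pi_div_three, e1, e2, Real.cos_neg, Real.cos_zero,
        Real.cos_pi, sub_self, sub_zero, zero_sub]
      norm_num
  rcases hcase with h | h | h | h
  · exfalso
    have h3 : syncPotential (torusProj z) = 3 := by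
      rw [h, torusProj, syncPotential_torusPt]
      norm_num
    linarith
  · have h1 : syncPotential (torusProj z) = -1 := by
      rcases h with rfl | rfl | rfl <;> rw [torusProj, syncPotential_torusPt] <;> norm_num
    obtain ⟨rfl, heq⟩ := hsame (hlow.trans h1.ge)
    rw [← heq]
    exact transverse_saddles ha ha' he hg h
  · refine sink _ (h ▸ hz) ?_ ?_ ?_ h <;>
      simp only [cos_two_pi_div_three, cos_four_pi_div_three, e1, Real.cos_neg]
  · refine sink _ (h ▸ hz) ?_ ?_ ?_ h <;>
      simp only [cos_two_pi_div_three, cos_four_pi_div_three, e2]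

theorem proposition2p1 (a : ℝ) (ha : 0 < a) (ha' : a < 1 / 3) :
    ∃ G : Torus ≃ₘ^1⟮torusModel, torusModel⟯ Torus,
      (∀ z, G z = syncMap a z) ∧
      IsMorseSmale torusModel G ∧
      nonwanderingSet G =
        {torusPt 0 0, torusPt 0 π, torusPt π 0, torusPt π π,
          torusPt (2 * π / 3) (4 * π / 3), torusPt (4 * π / 3) (2 * π / 3)} ∧
      (nonwanderingSet G).ncard = 6 ∧
      IsSource torusModel G (torusPt 0 0) ∧
      IsSaddle torusModel G (torusPt 0 π) ∧
      IsSaddle torusModel G (torusPt π 0) ∧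
      IsSaddle torusModel G (torusPt π π) ∧
      IsSink torusModel G (torusPt (2 * π / 3) (4 * π / 3)) ∧
      IsSink torusModel G (torusPt (4 * π / 3) (2 * π / 3)) := by
  obtain ⟨e, G, he, hes, hG, hg⟩ := exists_diffeomorph_syncMap ha ha'
  have hGf : (G : Torus → Torus) = syncMap a := funext hG
  have hgc : Continuous G.symm := G.symm.continuous
  have hgi : RightInverse G.symm (syncMap a) := fun w => by rw [← hG, G.apply_symm_apply]
  have hV := isStrictLyapunov_syncMap ha ha'
  have hV' := hV.symm hgc hgi
  have hfin : syncFixedPoints.Finite := by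
    unfold syncFixedPoints
    exact toFinite _
  have hfix := fixedPoints_syncMap ha ha'
  have hfix' : fixedPoints G.symm = fixedPoints (syncMap a) := by
    ext w
    constructor
    · intro h
      have h1 := hgi w
      rwa [show G.symm w = w from h] at h1
    · intro h
      have h1 : G w = w := (hG w).trans h
      have h2 := G.symm_apply_apply w
      rwa [h1] at h2
  have hnw := hV.nonwanderingSet_eq.trans hfix
  have hset : torusProj '' syncFixedPoints = {torusPt 0 0, torusPt 0 π, torusPt π 0, torusPt π π,
      torusPt (2 * π / 3) (4 * π / 3), torusPt (4 * π / 3) (2 * π / 3)} := by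
    simp only [syncFixedPoints, image_insert_eq, image_singleton, torusProj]
  have c1 := isSource_syncMap ha
  have c2 := isSaddle_syncMap_zero_pi ha ha'
  have c3 := isSaddle_syncMap_pi_zero ha ha'
  have c4 := isSaddle_syncMap_pi_pi ha ha'
  have c5 := isSink_syncMap_left ha ha'
  have c6 := isSink_syncMap_right ha ha'
  refine ⟨G, hG, ⟨?_, ?_, ?_, ?_⟩, ?_, ?_, ?_⟩
  · rw [hGf, hnw]
    exact hfin.image _
  · rw [hGf, hnw, hset]
    rintro p (rfl | rfl | rfl | rfl | rfl | rfl)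
    exacts [c1.2.1, c2.2.1, c3.2.1, c4.2.1, c5.2.1, c6.2.1]
  · intro x
    rw [hGf]
    constructor
    · obtain ⟨p, hp, hlim⟩ := hV.exists_tendsto (hfix ▸ hfin.image _) x
      rw [omegaLimitSet_eq_singleton hlim]
      exact isPeriodicOrbit_singleton hp
    · obtain ⟨p, hp, hlim⟩ := hV'.exists_tendsto (hfix' ▸ hfix ▸ hfin.image _) x
      rw [omegaLimitSet_eq_singleton hlim]
      exact isPeriodicOrbit_singleton (hfix'.subset hp)
  · rw [hGf]
    intro p hp q hq x hx
    have hp' : p ∈ fixedPoints (syncMap a) := hV.isFixedPt_of_mem_periodicPts hp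
    have hq' : q ∈ fixedPoints (syncMap a) := hV.isFixedPt_of_mem_periodicPts hq
    rw [hfix] at hp' hq'
    obtain ⟨z, hz, rfl⟩ := hp'
    obtain ⟨z', hz', rfl⟩ := hq'
    exact transverse_syncMap ha ha' he hes hg hgc hgi hz hz' hx.1 hx.2
  · rw [hGf, hnw, hset]
  · rw [hGf, hnw, injOn_torusProj_syncFixedPoints.ncard_image, ncard_syncFixedPoints]
  · rw [hGf]
    exact ⟨c1, c2, c3, c4, c5, c6⟩
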